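/- Let $n,m\ge 1$ be integers with $n+m>2$ and let $\mathbf b=(b_1,\dots,b_m)\in\mathbb R^m$. Write $\mathbb R^+=[0,\infty)$, $|\mathbf a|=\max_i|a_i|$ for $\mathbf a\in\mathbb Z^n$, and $\|x\|$ for the distance from $x\in\mathbb R$ to the nearest integer. For $\Psi:\mathbb Z^n\to\mathbb R^+$ with $\Psi(\mathbf a)\to0$ as $|\mathbf a|\to\infty$, let $W(\Psi)$ be the set of $X=(\mathbf x_1,\dots,\mathbf x_m)\in[0,1)^{n\times m}$, $\mathbf x_j\in\mathbb R^n$, such that $\|\mathbf a\cdot\mathbf x_j-b_j\|<\Psi(\mathbf a)$ for all $1\le j\le m$ holds for infinitely many $\mathbf a\in\mathbb Z^n$. A dimension function is a continuous, non-decreasing $f:\mathbb R^+\to\mathbb R^+$ with $f(r)\to0$ as $r\to0$. For $F\subset\mathbb R^k$ put $\mathcal H^f(F)=\sup_{\rho>0}\mathcal H^f_\rho(F)$, where $\mathcal H^f_\rho(F)$ is the infimum of $\sum_i f(r_i)$ over all covers of $F$ by countably many (Euclidean) balls of radii $r_i\le\rho$. Suppose that the divergent part of Schmidt's theorem holds for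 $n,m,\mathbf b$: for every $\Psi:\mathbb Z^n\to\mathbb R^+$ with $\Psi(\mathbf a)\to0$ as $|\mathbf a|\to\infty$ and $$\sum_{\mathbf a\in\mathbb Z^n}\Psi(\mathbf a)^m=\infty,$$ the set $W(\Psi)$ has $nm$-dimensional Lebesgue measure $1$. Then the corresponding Hausdorff measure statement holds for $n,m,\mathbf b$: for every $\Psi:\mathbb Z^n\to\mathbb R^+$ with $\Psi(\mathbf a)\to0$ as $|\mathbf a|\to\infty$ and every dimension function $f$ such that $r\mapsto r^{-nm}f(r)$ is monotonic on $(0,\infty)$ (non-decreasing or non-increasing) and $g:r\mapsto r^{-(n-1)m}f(r)$ (with $g(0)=0$) is a dimension function, if $$\sum_{\mathbf a\in\mathbb Z^n\setminus\{\mathbf 0\}} g\!\left(\frac{\Psi(\mathbf a)}{|\mathbf a|}\right)|\mathbf a|^m=\infty,$$ then $$\mathcal H^f\big(W(\Psi)\big)=\mathcal H^f\big([0,1)^{n\times m}\big).$$ -/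

import Mathlib

open Set Filter Topology MeasureTheory
open scoped NNReal ENNReal

noncomputable section

/-- A dimension function: a continuous, non-decreasing function `f : [0,∞) → [0,∞)` such that
`f r → 0` as `r → 0`. -/
structure IsDimensionFunction (f : ℝ≥0 → ℝ≥0) : Prop where
  continuous : Continuous f
  monotone : Monotone f
  tendsto_zero : Tendsto f (𝓝 0) (𝓝 0)

/-- `hausdorffPre f ρ F` is the infimum of `∑ i, f (r(B i))` over all covers of `F ⊆ ℝ^ι` by
countably many balls `B i` of radius at most `ρ`.
Balls of radius zero contribute `f 0 = 0` for a dimension function `f`, so that covers by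
finitely many balls are included. -/
def hausdorffPre {ι : Type*} [Fintype ι] (f : ℝ≥0 → ℝ≥0) (ρ : ℝ≥0)
    (F : Set (EuclideanSpace ℝ ι)) : ℝ≥0∞ :=
  ⨅ (c : ℕ → EuclideanSpace ℝ ι) (r : ℕ → ℝ≥0) (_ : ∀ i, r i ≤ ρ)
    (_ : F ⊆ ⋃ i, Metric.closedBall (c i) (r i : ℝ)), ∑' i, (f (r i) : ℝ≥0∞)

/-- The Hausdorff `f`-measure of a subset `F` of `ℝ^ι`. -/
def hausdorffFMeasure {ι : Type*} [Fintype ι] (f : ℝ≥0 → ℝ≥0)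
    (F : Set (EuclideanSpace ℝ ι)) : ℝ≥0∞ :=
  ⨆ (ρ : ℝ≥0) (_ : 0 < ρ), hausdorffPre f ρ F

/-- The distance from a real number to the nearest integer. -/
def distNearestInt (x : ℝ) : ℝ := |x - round x|

/-- The unit cube `[0,1)^{n × m}`; the point `X = (x_1, …, x_m)` with `x_j ∈ ℝ^n` has the
coordinates `x_{j,i} = X (j, i)`. -/
def unitCube (n m : ℕ) : Set (EuclideanSpace ℝ (Fin m × Fin n)) :=
  {X | ∀ p, X p ∈ Ico (0 : ℝ) 1}

/-- The set `W` of all `X` in the unit cube such that `‖a · x_j - b_j‖ < Ψ a` for all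
`1 ≤ j ≤ m` holds for infinitely many `a ∈ ℤ^n`. -/
def approxSet (n m : ℕ) (b : Fin m → ℝ) (Ψ : (Fin n → ℤ) → ℝ≥0) :
    Set (EuclideanSpace ℝ (Fin m × Fin n)) :=
  {X | X ∈ unitCube n m ∧
    {a : Fin n → ℤ |
      ∀ j, distNearestInt (∑ i, (a i : ℝ) * X (j, i) - b j) < (Ψ a : ℝ)}.Infinite}

/-- `Ψ a → 0` as `|a| → ∞`, where `|a| = max |a_i|` (this is the norm `‖a‖` on `Fin n → ℤ`). -/
def VanishesAtInfinity {n : ℕ} (Ψ : (Fin n → ℤ) → ℝ≥0) : Prop :=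
  Tendsto Ψ (comap (fun a => ‖a‖) atTop) (𝓝 0)

/-- The divergent part of Schmidt's theorem for the given `n`, `m` and `b`. -/
def SchmidtDivergentPart (n m : ℕ) (b : Fin m → ℝ) : Prop :=
  ∀ Ψ : (Fin n → ℤ) → ℝ≥0, VanishesAtInfinity Ψ →
    ∑' a : Fin n → ℤ, (Ψ a : ℝ≥0∞) ^ m = ∞ →
    volume (approxSet n m b Ψ) = 1

/-- The function `g : r ↦ r^{-(n-1)m} f(r)`; here `g 0 = 0` whenever `f 0 = 0`. -/
def slicedFunction (n m : ℕ) (f : ℝ≥0 → ℝ≥0) : ℝ≥0 → ℝ≥0 :=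
  fun r => f r / r ^ ((n - 1) * m)

/-- The divergent part of the general theorem on Hausdorff measures for the given `n`, `m`
and `b`. -/
def HausdorffDivergentPart (n m : ℕ) (b : Fin m → ℝ) : Prop :=
  ∀ Ψ : (Fin n → ℤ) → ℝ≥0, VanishesAtInfinity Ψ →
    ∀ f : ℝ≥0 → ℝ≥0, IsDimensionFunction f →
      (MonotoneOn (fun r => f r / r ^ (n * m)) (Ioi 0) ∨
        AntitoneOn (fun r => f r / r ^ (n * m)) (Ioi 0)) →
      IsDimensionFunction (slicedFunction n m f) →
      ∑' a : {a : Fin n → ℤ // a ≠ 0},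
        ((slicedFunction n m f (Ψ a.1 / ‖a.1‖₊) * ‖a.1‖₊ ^ m : ℝ≥0) : ℝ≥0∞) = ∞ →
      hausdorffFMeasure f (approxSet n m b Ψ) = hausdorffFMeasure f (unitCube n m)

end

/-! ### Loads of covers: comparing the gauge cost of balls with their volume. -/

section MassTransference

variable {σ : Type*} [Fintype σ]

/-! There are two regimes for `f r / r ^ (n * m)` near `0`. If it is bounded by `C`, then
`g(Ψ(a)/|a|) |a|^m ≤ C Ψ(a)^m` for all but finitely many `a`, so Schmidt's theorem for `Ψ` itself
gives full Lebesgue measure, and Lebesgue null sets are `f`-null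
(`hausdorffFMeasure_approxSet_of_bounded`).

Otherwise the quotient is non-increasing and unbounded, and `W(Ψ)` has infinite measure
(`hausdorffFMeasure_approxSet_eq_top`). Pick `i₀` with `|a_{i₀}| = |a|` along a divergent subseries
and freeze the coordinates `x_{j,i}`, `i ≠ i₀`. In the slice `ℝ^m` the condition for `a` describes
sup-norm balls of radius `Ψ(a)/|a|`. Apply Schmidt's theorem to `Φ(a)^m = η(a) min(1, g(Ψ(a)/|a|)
|a|^m)` on the subseries, with `η → 0` so slowly that the sum still diverges. By Fubini, in almost
every slice almost every point lies in infinitely many balls of radius `Φ(a)/|a|`, and the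
concentric balls of radius `Ψ(a)/|a|` are large in the gauge `g`. Mass transference
(`hasInfiniteGaugeMeasure_of_ubiquitous`) makes the slices infinite for `g`, and
`hausdorffFMeasure_eq_top_of_slices` integrates this over the slices.

Mass transference needs no auxiliary measure here: against a cover of finite `g`-cost, one nests
balls of which the cover meets only a small proportion (`exists_smaller_ball`), and the limit point
escapes the cover. -/

theorem volume_closedBall_pi_nnreal (c : σ → ℝ) (r : ℝ≥0) :
    volume (Metric.closedBall c r) = (2 * r : ℝ≥0∞) ^ Fintype.card σ := by
  rw [Real.volume_pi_closedBall c r.coe_nonneg, ENNReal.ofReal_pow (by positivity),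
    ENNReal.ofReal_mul (by norm_num), ENNReal.ofReal_coe_nnreal]
  norm_num

/-- The volumes of disjoint balls inside a ball add up to at most the volume of that ball. -/
theorem tsum_indicator_radius_pow_le {β : Type*} [Countable β] {c : β → σ → ℝ} {ρ : β → ℝ≥0}
    (hd : Pairwise (Function.onFun Disjoint fun b => Metric.closedBall (c b) (ρ b : ℝ)))
    {S : Set β} {d : σ → ℝ} {R : ℝ≥0}
    (hS : ∀ b ∈ S, Metric.closedBall (c b) (ρ b : ℝ) ⊆ Metric.closedBall d R) :
    ∑' b, S.indicator (fun b => (ρ b : ℝ≥0∞) ^ Fintype.card σ) b ≤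
      (R : ℝ≥0∞) ^ Fintype.card σ := by
  have h1 : ∑' b : S, volume (Metric.closedBall (c b) (ρ b : ℝ)) ≤
      volume (Metric.closedBall d (R : ℝ)) := by
    rw [← measure_iUnion]
    · exact measure_mono (iUnion_subset fun b => hS b b.2)
    · intro a b hab
      exact hd (fun h => hab (Subtype.ext h))
    · exact fun b => Metric.isClosed_closedBall.measurableSet
  simp only [volume_closedBall_pi_nnreal, mul_pow] at h1
  rw [ENNReal.tsum_mul_left] at h1
  rw [← tsum_subtype]
  exact (ENNReal.mul_le_mul_iff_right (by positivity) (by finiteness)).1 h1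

/-- The sum of the `m`-th powers of the radii of those balls `closedBall (d i) (s i)` that meet
`closedBall x R`. -/
noncomputable def hitLoad (m : ℕ) (d : ℕ → σ → ℝ) (s : ℕ → ℝ≥0) (x : σ → ℝ) (R : ℝ≥0) : ℝ≥0∞ :=
  ∑' i, {i | (Metric.closedBall (d i) (s i : ℝ) ∩ Metric.closedBall x (R : ℝ)).Nonempty}.indicator
    (fun i => (s i : ℝ≥0∞) ^ m) i

/-- The proportion of a ball which may be met by a cover. -/
noncomputable def loadConst (m : ℕ) : ℝ≥0 := (4 * 90 ^ m)⁻¹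

theorem loadConst_pos (m : ℕ) : 0 < loadConst m := by unfold loadConst; positivity

theorem loadConst_le_one (m : ℕ) : loadConst m ≤ 1 := by
  unfold loadConst
  apply inv_le_one_of_one_le₀
  have : (1 : ℝ≥0) ≤ 90 ^ m := one_le_pow₀ (by norm_num)
  nlinarith

/-- Converts cost into volume: a ball smaller than `r` costs at least its volume share of `g r`. -/
theorem gauge_mul_pow_le {m : ℕ} {g : ℝ≥0 → ℝ≥0}
    (hanti : AntitoneOn (fun r => g r / r ^ m) (Ioi 0)) {s r : ℝ≥0} (hs : 0 < s) (hsr : s ≤ r) :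
    g r * s ^ m ≤ g s * r ^ m := by
  have h := hanti (mem_Ioi.2 hs) (mem_Ioi.2 (hs.trans_le hsr)) hsr
  have h1 : 0 < s ^ m := pow_pos hs m
  have h2 : 0 < r ^ m := pow_pos (hs.trans_le hsr) m
  exact (div_le_div_iff₀ h2 h1).1 h

/-- A heavily loaded small ball costs at least its share of the big ball in the gauge `g`. -/
theorem pow_le_hit_sums {m : ℕ} {g : ℝ≥0 → ℝ≥0} (hmono : Monotone g)
    (hanti : AntitoneOn (fun r => g r / r ^ m) (Ioi 0))
    {d : ℕ → σ → ℝ} {s : ℕ → ℝ≥0} (hs : ∀ i, 0 < s i) {c : σ → ℝ} {r ρ ε : ℝ≥0} (hr : 0 < r)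
    (hε : ρ ^ m ≤ ε * g r)
    (hload : (loadConst m : ℝ≥0∞) * ((r / 2 : ℝ≥0) : ℝ≥0∞) ^ m < hitLoad m d s c (r / 2)) :
    (ρ : ℝ≥0∞) ^ m ≤
      (∑' i, {i | (Metric.closedBall (d i) (s i : ℝ) ∩
          Metric.closedBall c ((r / 2 : ℝ≥0) : ℝ)).Nonempty ∧ ρ ≤ s i}.indicator
            (fun _ => (ρ : ℝ≥0∞) ^ m) i) +
      ∑' i, {i | (Metric.closedBall (d i) (s i : ℝ) ∩
          Metric.closedBall c ((r / 2 : ℝ≥0) : ℝ)).Nonempty ∧ s i < ρ}.indicator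
            (fun i => ((ε * 2 ^ m * (loadConst m)⁻¹ * g (s i) : ℝ≥0) : ℝ≥0∞)) i := by
  set v := r / 2 with hv
  have hv0 : 0 < v := by positivity
  have hvr : v ≤ r := half_le_self hr.le
  -- The factor `2 ^ m` pays for replacing `g r` by `g (r / 2)`, the inverse for the proportion
  -- `loadConst m` in `hload`.
  set K := ε * 2 ^ m * (loadConst m)⁻¹ with hK
  have hκ := loadConst_pos m
  have hρ : ρ ^ m ≤ K * (loadConst m * g v) := by
    have h1 := gauge_mul_pow_le hanti hv0 hvr
    have h2 : r ^ m = 2 ^ m * v ^ m := by rw [← mul_pow, hv]; congr 1; field_simp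
    rw [h2, ← mul_assoc] at h1
    have h3 : g r ≤ g v * 2 ^ m := le_of_mul_le_mul_right h1 (pow_pos hv0 m)
    calc ρ ^ m ≤ ε * g r := hε
      _ ≤ ε * (g v * 2 ^ m) := by gcongr
      _ = K * (loadConst m * g v) := by rw [hK]; field_simp
  by_cases hbig : ∃ i, (Metric.closedBall (d i) (s i : ℝ) ∩
      Metric.closedBall c (v : ℝ)).Nonempty ∧ ρ ≤ s i
  · obtain ⟨i, hi⟩ := hbig
    refine le_add_right (le_trans ?_ (ENNReal.le_tsum i))
    rw [indicator_of_mem (by exact hi)]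
  push Not at hbig
  refine le_add_left ?_
  by_cases hmid : ∃ i, (Metric.closedBall (d i) (s i : ℝ) ∩
      Metric.closedBall c (v : ℝ)).Nonempty ∧ v ≤ s i
  · obtain ⟨i, hi, hvi⟩ := hmid
    refine le_trans ?_ (ENNReal.le_tsum i)
    rw [indicator_of_mem (by exact ⟨hi, hbig i hi⟩)]
    have : ρ ^ m ≤ K * g (s i) := by
      refine hρ.trans ?_
      gcongr
      calc loadConst m * g v ≤ 1 * g v := by gcongr; exact loadConst_le_one m
        _ ≤ g (s i) := by rw [one_mul]; exact hmono hvi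
    exact_mod_cast this
  push Not at hmid
  -- All cover balls that meet the ball now have radius below `v`, so each costs at least `g v * (s
  -- i / v) ^ m`, and the load adds up these shares.
  have key : ((K * g v : ℝ≥0) : ℝ≥0∞) * hitLoad m d s c v ≤
      (v : ℝ≥0∞) ^ m * ∑' i, {i | (Metric.closedBall (d i) (s i : ℝ) ∩
          Metric.closedBall c (v : ℝ)).Nonempty ∧ s i < ρ}.indicator
            (fun i => ((K * g (s i) : ℝ≥0) : ℝ≥0∞)) i := by
    unfold hitLoad
    rw [← ENNReal.tsum_mul_left, ← ENNReal.tsum_mul_left]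
    refine ENNReal.tsum_le_tsum fun i => ?_
    by_cases hi : (Metric.closedBall (d i) (s i : ℝ) ∩ Metric.closedBall c (v : ℝ)).Nonempty
    · rw [indicator_of_mem (by exact hi), indicator_of_mem (by exact ⟨hi, hbig i hi⟩)]
      have := gauge_mul_pow_le hanti (hs i) (hmid i hi).le
      have : K * g v * s i ^ m ≤ v ^ m * (K * g (s i)) := by
        calc K * g v * s i ^ m = K * (g v * s i ^ m) := by ring
          _ ≤ K * (g (s i) * v ^ m) := by gcongr
          _ = _ := by ring
      exact_mod_cast this
    · rw [indicator_of_notMem (by exact hi)]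
      simp
  have hvm : (v : ℝ≥0∞) ^ m ≠ 0 := by
    have := hv0.ne'
    positivity
  refine (ENNReal.mul_le_mul_iff_right hvm (by finiteness)).1 (le_trans ?_ key)
  calc (v : ℝ≥0∞) ^ m * (ρ : ℝ≥0∞) ^ m
      ≤ (v : ℝ≥0∞) ^ m * ((K * (loadConst m * g v) : ℝ≥0) : ℝ≥0∞) := by
        gcongr; exact_mod_cast hρ
    _ = ((K * g v : ℝ≥0) : ℝ≥0∞) * ((loadConst m : ℝ≥0∞) * (v : ℝ≥0∞) ^ m) := by
        push_cast; ring
    _ ≤ _ := by gcongr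

end MassTransference

/-! ### One step of the nested construction: a Vitali family and a charging argument. -/

section MassTransference

variable {σ : Type*} [Fintype σ]

/-- `O` contains, near almost every point of `U`, balls which are large in the gauge `g`: almost
every point lies in arbitrarily small balls `B(c, ρ)` with `ρ ^ m ≤ ε g(r)` and
`B(c, r) ⊆ O`. -/
def IsGaugeUbiquitous (g : ℝ≥0 → ℝ≥0) (U O : Set (σ → ℝ)) : Prop :=
  ∀ ε : ℝ≥0, 0 < ε → ∀ δ : ℝ≥0, 0 < δ → ∀ᵐ z : σ → ℝ, z ∈ U → ∃ (c : σ → ℝ) (r ρ : ℝ≥0),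
    dist z c < ρ ∧ 0 < r ∧ r ≤ ρ ∧ ρ ≤ δ ∧ ρ ^ Fintype.card σ ≤ ε * g r ∧
      Metric.ball c r ⊆ O

/-- Vitali covering lemma for balls of radius `3 ρ`, with the resulting estimate of the volume. -/
theorem exists_countable_disjoint_triples [Nonempty σ] {t : Set ((σ → ℝ) × ℝ≥0 × ℝ≥0)} {δ : ℝ≥0}
    (hδ : ∀ q ∈ t, 0 < q.2.2 ∧ q.2.2 ≤ δ) {x : σ → ℝ} {R : ℝ≥0}
    (hcov : ∀ᵐ z : σ → ℝ, z ∈ Metric.closedBall x (R : ℝ) → ∃ q ∈ t, dist z q.1 < q.2.2) :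
    ∃ u ⊆ t, u.Countable ∧
      (u.PairwiseDisjoint fun q => Metric.closedBall q.1 (3 * q.2.2 : ℝ)) ∧
      (R : ℝ≥0∞) ^ Fintype.card σ ≤
        15 ^ Fintype.card σ * ∑' q : u, (q.1.2.2 : ℝ≥0∞) ^ Fintype.card σ := by
  -- Disjointness is required at radius `3 ρ`, so that a small cover ball can meet only one member;
  -- the enlargement by `5` turns this into `15`.
  obtain ⟨u, hut, hdis, hu⟩ := Vitali.exists_disjoint_subfamily_covering_enlargement_closedBall
    t (fun q => q.1) (fun q => (3 * q.2.2 : ℝ)) (3 * δ)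
    (fun q hq => by have := (hδ q hq).2; gcongr) 5 (by norm_num)
  have hcount : u.Countable := by
    refine hdis.countable_of_nonempty_interior fun q hq => ?_
    refine ⟨q.1, Metric.ball_subset_interior_closedBall (Metric.mem_ball_self ?_)⟩
    have := (hδ q (hut hq)).1
    positivity
  refine ⟨u, hut, hcount, hdis, ?_⟩
  have hsub : volume (Metric.closedBall x (R : ℝ)) ≤
      volume (⋃ q ∈ u, Metric.closedBall q.1 ((15 * q.2.2 : ℝ≥0) : ℝ)) := by
    refine measure_mono_ae ?_
    filter_upwards [hcov] with z hz hzx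
    obtain ⟨q, hq, hzq⟩ := hz hzx
    obtain ⟨b, hb, hqb⟩ := hu q hq
    refine mem_iUnion₂.2 ⟨b, hb, ?_⟩
    have h1 : z ∈ Metric.closedBall q.1 (3 * q.2.2 : ℝ) := by
      have : (0 : ℝ) ≤ q.2.2 := q.2.2.coe_nonneg
      rw [Metric.mem_closedBall]
      linarith
    have h2 := hqb h1
    rw [Metric.mem_closedBall] at h2 ⊢
    push_cast
    linarith
  have h2 := hsub.trans (measure_biUnion_le volume hcount _)
  simp only [volume_closedBall_pi_nnreal, ENNReal.coe_mul, mul_pow] at h2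
  rw [ENNReal.tsum_mul_left, ENNReal.tsum_mul_left] at h2
  exact (ENNReal.mul_le_mul_iff_right (by positivity) (by finiteness)).1 h2

/-- Inside a ball carrying little load one finds smaller such balls inside a given ubiquitous
set. -/
theorem exists_smaller_ball [Nonempty σ] {g : ℝ≥0 → ℝ≥0} (hmono : Monotone g)
    (hanti : AntitoneOn (fun r => g r / r ^ Fintype.card σ) (Ioi 0))
    {d : ℕ → σ → ℝ} {s : ℕ → ℝ≥0} (hs : ∀ i, 0 < s i) (hsum : ∑' i, (g (s i) : ℝ≥0∞) ≠ ∞)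
    {U O : Set (σ → ℝ)} (hO : IsGaugeUbiquitous g U O) {x : σ → ℝ} {R : ℝ≥0} (hR : 0 < R)
    (hU : Metric.closedBall x (R : ℝ) ⊆ U)
    (hload : hitLoad (Fintype.card σ) d s x R ≤
      (loadConst (Fintype.card σ) : ℝ≥0∞) * (R : ℝ≥0∞) ^ Fintype.card σ) :
    ∃ (c : σ → ℝ) (r : ℝ≥0), 0 < r ∧ r ≤ R / 2 ∧
      Metric.closedBall c (r : ℝ) ⊆ O ∧
      Metric.closedBall c (r : ℝ) ⊆ Metric.closedBall x (R : ℝ) ∧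
      hitLoad (Fintype.card σ) d s c r ≤
        (loadConst (Fintype.card σ) : ℝ≥0∞) * (r : ℝ≥0∞) ^ Fintype.card σ := by
  set m := Fintype.card σ with hm
  have hκ := loadConst_pos m
  lift ∑' i, (g (s i) : ℝ≥0∞) to ℝ≥0 using hsum with T hT
  by_contra! hbad
  -- the parameters
  obtain ⟨ε, hε0, hε⟩ : ∃ ε : ℝ≥0, 0 < ε ∧
      30 ^ m * (ε * 2 ^ m * (loadConst m)⁻¹ * T) ≤ R ^ m / 4 := by
    refine ⟨R ^ m / (4 * 30 ^ m * 2 ^ m * (loadConst m)⁻¹ * (T + 1)), by positivity, ?_⟩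
    have h0 : T / (T + 1) ≤ 1 := div_le_one_of_le₀ (by simp) (by positivity)
    calc 30 ^ m * (R ^ m / (4 * 30 ^ m * 2 ^ m * (loadConst m)⁻¹ * (T + 1)) * 2 ^ m *
          (loadConst m)⁻¹ * T) = R ^ m / 4 * (T / (T + 1)) := by field_simp
      _ ≤ R ^ m / 4 * 1 := by gcongr
      _ = _ := mul_one _
  set K := ε * 2 ^ m * (loadConst m)⁻¹ with hK
  -- Centres chosen near `B(x, R / 2)` stay within `5 R / 8` of `x`, which keeps the selected balls
  -- inside `B(x, R)`.
  set δ := R / 8 with hδ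
  set t : Set ((σ → ℝ) × ℝ≥0 × ℝ≥0) := {q | 0 < q.2.1 ∧ q.2.1 ≤ q.2.2 ∧ q.2.2 ≤ δ ∧
    q.2.2 ^ m ≤ ε * g q.2.1 ∧ Metric.ball q.1 q.2.1 ⊆ O ∧ dist q.1 x ≤ R / 2 + δ} with ht
  have hRhalf : ((R / 2 : ℝ≥0) : ℝ) ≤ R := by push_cast; linarith [R.coe_nonneg]
  obtain ⟨u, hut, hcount, hdis, hvol⟩ := exists_countable_disjoint_triples
    (t := t) (δ := δ) (fun q hq => ⟨hq.1.trans_le hq.2.1, hq.2.2.1⟩) (x := x) (R := R / 2) (by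
      filter_upwards [hO ε hε0 δ (by positivity)] with z hz hzx
      obtain ⟨c, r, ρ, h1, h2, h3, h4, h5, h6⟩ := hz
        (hU (Metric.closedBall_subset_closedBall hRhalf hzx))
      refine ⟨(c, r, ρ), ⟨h2, h3, h4, h5, h6, ?_⟩, h1⟩
      have h7 : dist c x ≤ dist z c + dist z x := dist_triangle_left _ _ _
      have h8 : dist z x ≤ ((R / 2 : ℝ≥0) : ℝ) := hzx
      have h9 : (ρ : ℝ) ≤ δ := by exact_mod_cast h4
      push_cast at h8
      linarith)
  have := hcount.to_subtype
  -- every small ball is heavily loaded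
  have hheavy : ∀ q ∈ t, (loadConst m : ℝ≥0∞) * ((q.2.1 / 2 : ℝ≥0) : ℝ≥0∞) ^ m <
      hitLoad m d s q.1 (q.2.1 / 2) := by
    rintro ⟨c, r, ρ⟩ ⟨h1, h2, h3, h4, h5, h6⟩
    dsimp only at *
    have hr0 : (0 : ℝ) < r := by exact_mod_cast h1
    have h2' : (r : ℝ) ≤ ρ := by exact_mod_cast h2
    have h3' : (ρ : ℝ) ≤ R / 8 := by
      have : (ρ : ℝ) ≤ δ := by exact_mod_cast h3
      simpa [hδ] using this
    have h6' : dist c x ≤ R / 2 + R / 8 := by simpa [hδ] using h6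
    refine hbad c (r / 2) (by positivity) ?_ ?_ ?_
    · rw [← NNReal.coe_le_coe]; push_cast; linarith
    · refine (Metric.closedBall_subset_ball ?_).trans h5
      push_cast; linarith
    · refine Metric.closedBall_subset_closedBall' ?_
      push_cast; linarith
  have hdis' : Pairwise (Function.onFun Disjoint
      fun q : u => Metric.closedBall q.1.1 (q.1.2.2 : ℝ)) := by
    intro a b hab
    have := hdis a.2 b.2 (fun h => hab (Subtype.ext h))
    refine this.mono (Metric.closedBall_subset_closedBall ?_)
      (Metric.closedBall_subset_closedBall ?_)
    · linarith [a.1.2.2.coe_nonneg]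
    · linarith [b.1.2.2.coe_nonneg]
  have hsmall : ∀ q : u, q.1.2.1 / 2 ≤ q.1.2.2 / 2 := fun q => by
    have := (hut q.2).2.1
    gcongr
  have hinR : ∀ q : u, Metric.closedBall q.1.1 ((q.1.2.1 / 2 : ℝ≥0) : ℝ) ⊆
      Metric.closedBall x (R : ℝ) := by
    rintro ⟨⟨c, r, ρ⟩, hq⟩
    obtain ⟨h1, h2, h3, h4, h5, h6⟩ := hut hq
    dsimp only at *
    have h2' : (r : ℝ) ≤ ρ := by exact_mod_cast h2
    have h3' : (ρ : ℝ) ≤ R / 8 := by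
      have : (ρ : ℝ) ≤ δ := by exact_mod_cast h3
      simpa [hδ] using this
    have h6' : dist c x ≤ R / 2 + R / 8 := by simpa [hδ] using h6
    refine Metric.closedBall_subset_closedBall' ?_
    push_cast; linarith [R.coe_nonneg]
  -- summing up over the balls of the subfamily
  have hA : ∀ i, ∑' q : u, {i | (Metric.closedBall (d i) (s i : ℝ) ∩
      Metric.closedBall q.1.1 ((q.1.2.1 / 2 : ℝ≥0) : ℝ)).Nonempty ∧ q.1.2.2 ≤ s i}.indicator
        (fun _ => (q.1.2.2 : ℝ≥0∞) ^ m) i ≤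
      3 ^ m * {i | (Metric.closedBall (d i) (s i : ℝ) ∩
        Metric.closedBall x (R : ℝ)).Nonempty}.indicator (fun i => (s i : ℝ≥0∞) ^ m) i := by
    intro i
    by_cases hi : (Metric.closedBall (d i) (s i : ℝ) ∩ Metric.closedBall x (R : ℝ)).Nonempty
    · rw [indicator_of_mem (by exact hi), ← mul_pow]
      have h3s : (3 * (s i : ℝ≥0∞)) = ((3 * s i : ℝ≥0) : ℝ≥0∞) := by push_cast; rfl
      rw [h3s]
      -- The disjoint balls of radius `ρ ≤ s i` charged to the cover ball `i` all lie in `B(d i, 3 *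
      -- s i)`.
      refine le_trans (le_of_eq ?_) (tsum_indicator_radius_pow_le hdis' (d := d i)
        (S := {q : u | (Metric.closedBall (d i) (s i : ℝ) ∩
          Metric.closedBall q.1.1 ((q.1.2.1 / 2 : ℝ≥0) : ℝ)).Nonempty ∧ q.1.2.2 ≤ s i}) ?_)
      · rfl
      · rintro q ⟨⟨y, hy1, hy2⟩, hq⟩
        refine Metric.closedBall_subset_closedBall' ?_
        have h1 : dist q.1.1 (d i) ≤ dist y q.1.1 + dist y (d i) := dist_triangle_left _ _ _
        have h2 : dist y q.1.1 ≤ ((q.1.2.1 / 2 : ℝ≥0) : ℝ) := hy2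
        have h3 : dist y (d i) ≤ s i := hy1
        have h4 : ((q.1.2.1 / 2 : ℝ≥0) : ℝ) ≤ ((q.1.2.2 / 2 : ℝ≥0) : ℝ) := by
          exact_mod_cast hsmall q
        have h5 : (q.1.2.2 : ℝ) ≤ s i := by exact_mod_cast hq
        push_cast at *
        linarith [q.1.2.2.coe_nonneg]
    · refine le_of_eq_of_le (ENNReal.tsum_eq_zero.2 fun q => ?_) (zero_le)
      rw [indicator_of_notMem]
      refine fun h => hi ?_
      exact h.1.mono (inter_subset_inter_right _ (hinR q))
  -- A cover ball smaller than `ρ` that meets the inner ball has its centre in the tripled ball;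
  -- these are disjoint, so it is charged at most once.
  have hB : ∀ i, ∑' q : u, {i | (Metric.closedBall (d i) (s i : ℝ) ∩
      Metric.closedBall q.1.1 ((q.1.2.1 / 2 : ℝ≥0) : ℝ)).Nonempty ∧ s i < q.1.2.2}.indicator
        (fun i => ((K * g (s i) : ℝ≥0) : ℝ≥0∞)) i ≤ ((K * g (s i) : ℝ≥0) : ℝ≥0∞) := by
    intro i
    have huniq : ∀ q : u, ((Metric.closedBall (d i) (s i : ℝ) ∩
        Metric.closedBall q.1.1 ((q.1.2.1 / 2 : ℝ≥0) : ℝ)).Nonempty ∧ s i < q.1.2.2) →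
        d i ∈ Metric.closedBall q.1.1 (3 * q.1.2.2 : ℝ) := by
      rintro q ⟨⟨y, hy1, hy2⟩, hq⟩
      have h1 : dist (d i) q.1.1 ≤ dist y (d i) + dist y q.1.1 := dist_triangle_left _ _ _
      have h2 : dist y q.1.1 ≤ ((q.1.2.1 / 2 : ℝ≥0) : ℝ) := hy2
      have h3 : dist y (d i) ≤ s i := hy1
      have h4 : ((q.1.2.1 / 2 : ℝ≥0) : ℝ) ≤ ((q.1.2.2 / 2 : ℝ≥0) : ℝ) := by
        exact_mod_cast hsmall q
      have h5 : (s i : ℝ) < q.1.2.2 := by exact_mod_cast hq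
      rw [Metric.mem_closedBall]
      push_cast at *
      linarith [q.1.2.2.coe_nonneg]
    by_cases hex : ∃ q : u, ((Metric.closedBall (d i) (s i : ℝ) ∩
        Metric.closedBall q.1.1 ((q.1.2.1 / 2 : ℝ≥0) : ℝ)).Nonempty ∧ s i < q.1.2.2)
    · obtain ⟨q₀, hq₀⟩ := hex
      rw [tsum_eq_single q₀]
      · exact indicator_le_self' (fun _ _ => zero_le) _
      · intro q hq
        rw [indicator_of_notMem]
        intro h
        exact (hdis q.2 q₀.2 (fun h => hq (Subtype.ext h))).le_bot
          ⟨huniq q h, huniq q₀ hq₀⟩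
    · refine le_of_eq_of_le (ENNReal.tsum_eq_zero.2 fun q => ?_) (zero_le)
      rw [indicator_of_notMem]
      exact fun h => hex ⟨q, h⟩
  have htotal : ∑' q : u, (q.1.2.2 : ℝ≥0∞) ^ m ≤
      3 ^ m * hitLoad m d s x R + ((K * T : ℝ≥0) : ℝ≥0∞) := by
    refine (ENNReal.tsum_le_tsum fun q : u => pow_le_hit_sums hmono hanti hs
      (hut q.2).1 (hut q.2).2.2.2.1 (hheavy q (hut q.2))).trans ?_
    rw [ENNReal.tsum_add, ENNReal.tsum_comm]
    refine add_le_add ?_ ?_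
    · unfold hitLoad
      rw [← ENNReal.tsum_mul_left]
      exact ENNReal.tsum_le_tsum hA
    · rw [ENNReal.tsum_comm]
      refine (ENNReal.tsum_le_tsum hB).trans (le_of_eq ?_)
      push_cast
      rw [hT, ENNReal.tsum_mul_left]
  have hfinal : R ^ m ≤ 30 ^ m * (3 ^ m * (loadConst m * R ^ m) + K * T) := by
    have h1 : ((R / 2 : ℝ≥0) : ℝ≥0∞) ^ m ≤
        15 ^ m * (3 ^ m * (loadConst m * R ^ m) + ((K * T : ℝ≥0) : ℝ≥0∞)) :=
      hvol.trans (by gcongr; exact htotal.trans (by gcongr))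
    have h2 : (R / 2) ^ m ≤ 15 ^ m * (3 ^ m * (loadConst m * R ^ m) + K * T) := by
      exact_mod_cast h1
    calc R ^ m = 2 ^ m * (R / 2) ^ m := by rw [← mul_pow]; congr 1; field_simp
      _ ≤ 2 ^ m * (15 ^ m * (3 ^ m * (loadConst m * R ^ m) + K * T)) := by gcongr
      _ = _ := by rw [← mul_assoc, ← mul_pow]; norm_num
  -- Origin of `90 = 2 * 15 * 3` in `loadConst`: halving `R`, Vitali enlargement, tripled cover
  -- balls.
  have hc : (30 : ℝ≥0) ^ m * (3 ^ m * (loadConst m * R ^ m)) = R ^ m / 4 := by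
    have : (90 : ℝ≥0) ^ m = 30 ^ m * 3 ^ m := by rw [← mul_pow]; norm_num
    unfold loadConst
    rw [this]
    field_simp
  rw [mul_add, hc] at hfinal
  have hpos : 0 < R ^ m := pow_pos hR m
  have h5 : R ^ m ≤ R ^ m / 4 + R ^ m / 4 := hfinal.trans (by gcongr)
  have h6 : (R ^ m : ℝ) ≤ R ^ m / 4 + R ^ m / 4 := by exact_mod_cast h5
  have h7 : (0 : ℝ) < R ^ m := by exact_mod_cast hpos
  linarith

end MassTransference

/-! ### The mass transference principle. -/

section MassTransference

variable {σ : Type*} [Fintype σ]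

/-- The set `A` has infinite Hausdorff `g`-measure with respect to the supremum norm. -/
def HasInfiniteGaugeMeasure (g : ℝ≥0 → ℝ≥0) (A : Set (σ → ℝ)) : Prop :=
  ∀ T : ℝ≥0, ∃ ρ : ℝ≥0, 0 < ρ ∧ ∀ (d : ℕ → σ → ℝ) (s : ℕ → ℝ≥0), (∀ i, s i ≤ ρ) →
    A ⊆ ⋃ i, Metric.closedBall (d i) (s i : ℝ) → (T : ℝ≥0∞) ≤ ∑' i, (g (s i) : ℝ≥0∞)

/-- Balls carrying little load contain points of all the ubiquitous sets outside the cover. -/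
theorem exists_mem_notMem_cover [Nonempty σ] {g : ℝ≥0 → ℝ≥0} (hmono : Monotone g)
    (hanti : AntitoneOn (fun r => g r / r ^ Fintype.card σ) (Ioi 0))
    {d : ℕ → σ → ℝ} {s : ℕ → ℝ≥0} (hs : ∀ i, 0 < s i) (hsum : ∑' i, (g (s i) : ℝ≥0∞) ≠ ∞)
    {U : Set (σ → ℝ)} {O : ℕ → Set (σ → ℝ)} (hO : ∀ N, IsGaugeUbiquitous g U (O N))
    {x : σ → ℝ} {R : ℝ≥0} (hR : 0 < R) (hU : Metric.closedBall x (R : ℝ) ⊆ U)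
    (hload : hitLoad (Fintype.card σ) d s x R ≤
      (loadConst (Fintype.card σ) : ℝ≥0∞) * (R : ℝ≥0∞) ^ Fintype.card σ) :
    ∃ z ∈ U, (∀ N, z ∈ O N) ∧ ∀ i, z ∉ Metric.closedBall (d i) (s i : ℝ) := by
  let St := {q : (σ → ℝ) × ℝ≥0 // 0 < q.2 ∧ Metric.closedBall q.1 (q.2 : ℝ) ⊆ U ∧
    hitLoad (Fintype.card σ) d s q.1 q.2 ≤
      (loadConst (Fintype.card σ) : ℝ≥0∞) * (q.2 : ℝ≥0∞) ^ Fintype.card σ}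
  have hstep : ∀ (N : ℕ) (q : St), ∃ q' : St, q'.1.2 ≤ q.1.2 / 2 ∧
      Metric.closedBall q'.1.1 (q'.1.2 : ℝ) ⊆ O N ∧
      Metric.closedBall q'.1.1 (q'.1.2 : ℝ) ⊆ Metric.closedBall q.1.1 (q.1.2 : ℝ) := by
    rintro N ⟨⟨y, r⟩, h1, h2, h3⟩
    obtain ⟨c, r', h4, h5, h6, h7, h8⟩ := exists_smaller_ball hmono hanti hs hsum (hO N) h1 h2 h3
    exact ⟨⟨(c, r'), h4, h7.trans h2, h8⟩, h5, h6, h7⟩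
  choose next hn1 hn2 hn3 using hstep
  let B : ℕ → St := fun k => Nat.rec ⟨(x, R), hR, hU, hload⟩ next k
  have hB : ∀ k, B (k + 1) = next k (B k) := fun k => rfl
  have hrad : ∀ k, (B k).1.2 ≤ R * (1 / 2) ^ k := by
    intro k
    induction k with
    | zero => simp [B]
    | succ k ih =>
      rw [hB]
      refine (hn1 k (B k)).trans ?_
      calc (B k).1.2 / 2 ≤ R * (1 / 2) ^ k / 2 := by gcongr
        _ = _ := by rw [pow_succ]; ring
  obtain ⟨z, hz⟩ := IsCompact.nonempty_iInter_of_sequence_nonempty_isCompact_isClosed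
    (fun k => Metric.closedBall (B k).1.1 ((B k).1.2 : ℝ))
    (fun k => hn3 k (B k))
    (fun k => ⟨(B k).1.1, Metric.mem_closedBall_self (NNReal.coe_nonneg _)⟩)
    (isCompact_closedBall _ _) (fun k => Metric.isClosed_closedBall)
  rw [mem_iInter] at hz
  refine ⟨z, (B 0).2.2.1 (hz 0), fun N => hn2 N (B N) (hz (N + 1)), fun i hi => ?_⟩
  -- A cover ball containing `z` meets every `B k`, so the load bound forces its radius below radii
  -- tending to zero.
  have hle : ∀ k, s i ≤ (B k).1.2 := by
    intro k
    have h1 : (s i : ℝ≥0∞) ^ Fintype.card σ ≤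
        hitLoad (Fintype.card σ) d s (B k).1.1 (B k).1.2 := by
      unfold hitLoad
      refine le_trans ?_ (ENNReal.le_tsum i)
      rw [indicator_of_mem]
      exact ⟨z, hi, hz k⟩
    have h2 : (s i) ^ Fintype.card σ ≤
        loadConst (Fintype.card σ) * (B k).1.2 ^ Fintype.card σ := by
      exact_mod_cast h1.trans (B k).2.2.2
    have h3 : (s i) ^ Fintype.card σ ≤ (B k).1.2 ^ Fintype.card σ :=
      h2.trans (mul_le_of_le_one_left zero_le (loadConst_le_one _))
    exact (pow_le_pow_iff_left₀ zero_le zero_le Fintype.card_ne_zero).1 h3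
  have hlim : Tendsto (fun k : ℕ => R * (1 / 2 : ℝ≥0) ^ k) atTop (𝓝 (R * 0)) :=
    Tendsto.const_mul R (NNReal.tendsto_pow_atTop_nhds_zero_of_lt_one (by
      rw [div_lt_one (by norm_num)]; norm_num))
  have h0 := ge_of_tendsto' hlim (fun k => (hle k).trans (hrad k))
  rw [mul_zero] at h0
  exact (hs i).not_ge h0

/-- The mass transference principle in the supremum norm. -/
theorem hasInfiniteGaugeMeasure_of_ubiquitous [Nonempty σ] {g : ℝ≥0 → ℝ≥0} (hmono : Monotone g)
    (hzero : Tendsto g (𝓝 0) (𝓝 0))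
    (hanti : AntitoneOn (fun r => g r / r ^ Fintype.card σ) (Ioi 0))
    (hunb : ∀ C : ℝ≥0, ∃ r : ℝ≥0, 0 < r ∧ C < g r / r ^ Fintype.card σ)
    {U : Set (σ → ℝ)} {O : ℕ → Set (σ → ℝ)} (hO : ∀ N, IsGaugeUbiquitous g U (O N))
    {x : σ → ℝ} {R : ℝ≥0} (hR : 0 < R) (hU : Metric.closedBall x (R : ℝ) ⊆ U) :
    HasInfiniteGaugeMeasure g {z ∈ U | ∀ N, z ∈ O N} := by
  intro T
  set m := Fintype.card σ with hm
  have hκ := loadConst_pos m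
  -- At this scale every cover of cost at most `T + 1` puts an admissible load on the initial ball
  -- `B(x, R)`.
  obtain ⟨ρ, hρ0, hρ⟩ := hunb ((T + 1) / (loadConst m * R ^ m))
  refine ⟨ρ, hρ0, fun d s hsρ hcov => ?_⟩
  by_contra! hlt
  obtain ⟨η, hη0, hη⟩ := ENNReal.exists_pos_sum_of_countable (one_ne_zero) ℕ
  have ht : ∀ i, ∃ t : ℝ≥0, 0 < t ∧ t ≤ ρ ∧ g t ≤ η i := by
    intro i
    have h1 : ∀ᶠ t in 𝓝[>] (0 : ℝ≥0), g t < η i :=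
      (hzero.eventually (gt_mem_nhds (hη0 i))).filter_mono nhdsWithin_le_nhds
    have h2 : ∀ᶠ t in 𝓝[>] (0 : ℝ≥0), t < ρ :=
      (gt_mem_nhds hρ0 : ∀ᶠ t in 𝓝 (0 : ℝ≥0), t < ρ).filter_mono nhdsWithin_le_nhds
    obtain ⟨t, h3, h4, h5⟩ := (h1.and (h2.and self_mem_nhdsWithin)).exists
    exact ⟨t, h5, h4.le, h3.le⟩
  choose t ht0 htρ hgt using ht
  -- Radii must be positive for the load argument; the enlargement costs at most `1` in total.
  set s' : ℕ → ℝ≥0 := fun i => max (s i) (t i) with hs'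
  have hs'0 : ∀ i, 0 < s' i := fun i => lt_max_of_lt_right (ht0 i)
  have hs'ρ : ∀ i, s' i ≤ ρ := fun i => max_le (hsρ i) (htρ i)
  have hg' : ∀ i, (g (s' i) : ℝ≥0∞) ≤ g (s i) + η i := by
    intro i
    have : g (s' i) ≤ g (s i) + η i := by
      rcases max_cases (s i) (t i) with h | h
      · simp only [hs', h.1]; exact le_self_add
      · simp only [hs', h.1]; exact (hgt i).trans le_add_self
    exact_mod_cast this
  have hsum : ∑' i, (g (s' i) : ℝ≥0∞) ≤ ((T + 1 : ℝ≥0) : ℝ≥0∞) := by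
    refine (ENNReal.tsum_le_tsum hg').trans ?_
    rw [ENNReal.tsum_add]
    push_cast
    exact add_le_add hlt.le hη.le
  have hload : hitLoad m d s' x R ≤ (loadConst m : ℝ≥0∞) * (R : ℝ≥0∞) ^ m := by
    have h1 : (g ρ : ℝ≥0∞) * hitLoad m d s' x R ≤ ((T + 1 : ℝ≥0) : ℝ≥0∞) * (ρ : ℝ≥0∞) ^ m := by
      refine le_trans ?_ (mul_le_mul_left hsum _)
      unfold hitLoad
      rw [← ENNReal.tsum_mul_left, ← ENNReal.tsum_mul_right]
      refine ENNReal.tsum_le_tsum fun i => ?_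
      refine (mul_le_mul_right (indicator_le_self' (fun _ _ => zero_le) _) _).trans ?_
      have := gauge_mul_pow_le hanti (hs'0 i) (hs'ρ i)
      dsimp only
      exact_mod_cast this
    have h2 : (T + 1) * ρ ^ m ≤ g ρ * (loadConst m * R ^ m) := by
      rw [div_lt_div_iff₀ (by positivity) (pow_pos hρ0 m)] at hρ
      exact hρ.le
    have h3 : g ρ ≠ 0 := by
      rintro h
      rw [h, zero_div] at hρ
      exact not_lt_zero hρ
    refine (ENNReal.mul_le_mul_iff_right (a := (g ρ : ℝ≥0∞)) (by exact_mod_cast h3)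
      (by finiteness)).1 (h1.trans ?_)
    exact_mod_cast h2
  obtain ⟨z, hzU, hzO, hz⟩ := exists_mem_notMem_cover hmono hanti hs'0
    (hsum.trans_lt ENNReal.coe_lt_top).ne hO hR hU hload
  obtain ⟨i, hi⟩ := mem_iUnion.1 (hcov ⟨hzU, hzO⟩)
  refine hz i (Metric.closedBall_subset_closedBall ?_ hi)
  exact_mod_cast le_max_left (s i) (t i)

end MassTransference

/-! ### Slicing: from infinite `g`-measure of slices to infinite `f`-measure. -/

section Slicing

variable {κ : Type*} (p : κ → Prop) [DecidablePred p]

/-- The point of `ℝ^κ` with coordinates `z` where `p` holds and `y` elsewhere. -/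
def gluePoint (z : {i // p i} → ℝ) (y : {i // ¬p i} → ℝ) : EuclideanSpace ℝ κ :=
  WithLp.toLp 2 fun i => if h : p i then z ⟨i, h⟩ else y ⟨i, h⟩

theorem gluePoint_apply_of_pos (z : {i // p i} → ℝ) (y : {i // ¬p i} → ℝ) (i : {i // p i}) :
    gluePoint p z y i = z i := by
  simp [gluePoint, i.2]

theorem gluePoint_apply_of_neg (z : {i // p i} → ℝ) (y : {i // ¬p i} → ℝ) (i : {i // ¬p i}) :
    gluePoint p z y i = y i := by
  simp [gluePoint, i.2]

variable [Fintype κ]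

theorem measurePreserving_gluePoint :
    MeasurePreserving (fun q : ({i // p i} → ℝ) × ({i // ¬p i} → ℝ) => gluePoint p q.1 q.2) :=
  (PiLp.volume_preserving_toLp κ).comp
    (volume_preserving_piEquivPiSubtypeProd (fun _ : κ => ℝ) p).symm

/-- If a large set of slices of `F` has infinite `g`-measure, then `F` has infinite
`f`-measure. -/
theorem hausdorffFMeasure_eq_top_of_slices {f g : ℝ≥0 → ℝ≥0} (hg0 : g 0 = 0)
    (hfg : ∀ r, g r * r ^ Fintype.card {i // ¬p i} ≤ f r) {F : Set (EuclideanSpace ℝ κ)}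
    {Y : Set ({i // ¬p i} → ℝ)} (hY : volume Y ≠ 0)
    (hF : ∀ᵐ y ∂volume.restrict Y, HasInfiniteGaugeMeasure g {z | gluePoint p z y ∈ F}) :
    hausdorffFMeasure f F = ∞ := by
  by_contra hne
  set q := Fintype.card {i // ¬p i} with hq
  have hcover : ∀ k : ℕ, ∃ (c : ℕ → EuclideanSpace ℝ κ) (r : ℕ → ℝ≥0),
      (∀ i, r i ≤ 1 / ((k : ℝ≥0) + 1)) ∧ F ⊆ ⋃ i, Metric.closedBall (c i) (r i : ℝ) ∧
      ∑' i, (f (r i) : ℝ≥0∞) < hausdorffFMeasure f F + 1 := by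
    intro k
    have h1 : hausdorffPre f (1 / ((k : ℝ≥0) + 1)) F < hausdorffFMeasure f F + 1 := by
      refine lt_of_le_of_lt ?_ (ENNReal.lt_add_right hne one_ne_zero)
      unfold hausdorffFMeasure
      exact le_iSup₂_of_le (1 / ((k : ℝ≥0) + 1)) (by positivity) le_rfl
    unfold hausdorffPre at h1
    simp only [iInf_lt_iff] at h1
    obtain ⟨c, r, h2, h3, h4⟩ := h1
    exact ⟨c, r, h2, h3, h4⟩
  choose c r hr hc hsum using hcover
  let cy : ℕ → ℕ → {i // ¬p i} → ℝ := fun k i j => c k i j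
  -- `h k y` is the `g`-cost of the cover induced on the slice over `y`. Its integral is controlled
  -- by the `f`-cost, while it tends to infinity on almost every slice; Fatou's lemma gives the
  -- contradiction.
  let h : ℕ → ({i // ¬p i} → ℝ) → ℝ≥0∞ := fun k y =>
    ∑' i, (Metric.closedBall (cy k i) (r k i : ℝ)).indicator (fun _ => (g (r k i) : ℝ≥0∞)) y
  have hmeas : ∀ k, Measurable (h k) := fun k => Measurable.tsum fun i =>
    measurable_const.indicator Metric.isClosed_closedBall.measurableSet
  have hint : ∀ k, ∫⁻ y in Y, h k y ≤ 2 ^ q * (hausdorffFMeasure f F + 1) := by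
    intro k
    refine (setLIntegral_le_lintegral _ _).trans ?_
    refine le_trans ?_ (mul_le_mul_right (hsum k).le _)
    simp only [h]
    rw [lintegral_tsum fun i => (measurable_const.indicator
      Metric.isClosed_closedBall.measurableSet).aemeasurable, ← ENNReal.tsum_mul_left]
    refine ENNReal.tsum_le_tsum fun i => ?_
    rw [lintegral_indicator_const Metric.isClosed_closedBall.measurableSet,
      volume_closedBall_pi_nnreal]
    have h1 : g (r k i) * (2 * r k i) ^ q ≤ 2 ^ q * f (r k i) := by
      calc g (r k i) * (2 * r k i) ^ q = 2 ^ q * (g (r k i) * r k i ^ q) := by ring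
        _ ≤ _ := by gcongr; exact hfg _
    exact_mod_cast h1
  have hliminf : ∀ᵐ y ∂volume.restrict Y, liminf (fun k => h k y) atTop = ∞ := by
    filter_upwards [hF] with y hy
    refine ENNReal.eq_top_of_forall_nnreal_le fun T => ?_
    obtain ⟨ρ, hρ0, hρ⟩ := hy T
    refine le_liminf_of_le (by isBoundedDefault) ?_
    have hev : ∀ᶠ k : ℕ in atTop, 1 / ((k : ℝ≥0) + 1) < ρ :=
      (tendsto_one_div_add_atTop_nhds_zero_nat).eventually (gt_mem_nhds hρ0)
    filter_upwards [hev] with k hk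
    classical
    -- Balls that miss the slice get radius zero, at cost `g 0 = 0`.
    refine (hρ (fun i j => c k i j)
      (fun i => if y ∈ Metric.closedBall (cy k i) (r k i : ℝ) then r k i else 0) ?_ ?_).trans ?_
    · intro i
      split_ifs
      · exact (hr k i).trans hk.le
      · exact zero_le
    · intro z hz
      obtain ⟨i, hi⟩ := mem_iUnion.1 (hc k hz)
      rw [Metric.mem_closedBall, dist_eq_norm] at hi
      have hcoord : ∀ j, dist (gluePoint p z y j) (c k i j) ≤ r k i := fun j => by
        have := (PiLp.norm_apply_le (gluePoint p z y - c k i) j).trans hi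
        rwa [PiLp.sub_apply, ← dist_eq_norm] at this
      have hyi : y ∈ Metric.closedBall (cy k i) (r k i : ℝ) := by
        rw [Metric.mem_closedBall, dist_pi_le_iff (NNReal.coe_nonneg _)]
        intro j
        have := hcoord j
        rwa [gluePoint_apply_of_neg] at this
      refine mem_iUnion.2 ⟨i, ?_⟩
      rw [if_pos hyi, Metric.mem_closedBall, dist_pi_le_iff (NNReal.coe_nonneg _)]
      intro j
      have := hcoord j
      rwa [gluePoint_apply_of_pos] at this
    · refine ENNReal.tsum_le_tsum fun i => ?_
      by_cases hyi : y ∈ Metric.closedBall (cy k i) (r k i : ℝ)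
      · rw [if_pos hyi, indicator_of_mem hyi]
      · rw [if_neg hyi, hg0]; simp
  have hfatou := lintegral_liminf_le (μ := volume.restrict Y) (u := atTop) hmeas
  rw [lintegral_congr_ae hliminf, lintegral_const, Measure.restrict_apply_univ,
    ENNReal.top_mul hY] at hfatou
  have hle : liminf (fun k => ∫⁻ y in Y, h k y) atTop ≤ 2 ^ q * (hausdorffFMeasure f F + 1) :=
    liminf_le_of_le (by isBoundedDefault) fun b hb => by
      obtain ⟨k, hk⟩ := hb.exists
      exact hk.trans (hint k)
  refine (lt_top_iff_ne_top.1 (hle.trans_lt ?_)) (top_le_iff.1 hfatou)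
  exact ENNReal.mul_lt_top (by finiteness) (by finiteness)

end Slicing

/-! ### Elementary properties of the Hausdorff `f`-measure. -/

section HausdorffMeasure

variable {ι : Type*} [Fintype ι]

/-- Unused indices are filled with balls of radius zero, which cost `f 0 = 0`. -/
theorem hausdorffPre_le_tsum_of_countable {β : Type*} [Countable β] {f : ℝ≥0 → ℝ≥0}
    (hf0 : f 0 = 0) {ρ : ℝ≥0} {F : Set (EuclideanSpace ℝ ι)} (c : β → EuclideanSpace ℝ ι)
    (r : β → ℝ≥0) (hr : ∀ i, r i ≤ ρ) (hF : F ⊆ ⋃ i, Metric.closedBall (c i) (r i : ℝ)) :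
    hausdorffPre f ρ F ≤ ∑' i, (f (r i) : ℝ≥0∞) := by
  obtain ⟨e, he⟩ := exists_injective_nat β
  unfold hausdorffPre
  refine iInf_le_of_le (Function.extend e c 0) (iInf_le_of_le (Function.extend e r 0)
    (iInf_le_of_le ?_ (iInf_le_of_le ?_ ?_)))
  · intro k
    by_cases hk : ∃ i, e i = k
    · obtain ⟨i, rfl⟩ := hk
      rw [he.extend_apply]
      exact hr i
    · rw [Function.extend_apply' _ _ _ hk]
      exact zero_le
  · intro x hx
    obtain ⟨i, hi⟩ := mem_iUnion.1 (hF hx)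
    refine mem_iUnion.2 ⟨e i, ?_⟩
    rwa [he.extend_apply, he.extend_apply]
  · rw [← tsum_extend_zero he]
    refine ENNReal.tsum_le_tsum fun k => ?_
    by_cases hk : ∃ i, e i = k
    · obtain ⟨i, rfl⟩ := hk
      rw [he.extend_apply, he.extend_apply]
    · rw [Function.extend_apply' _ _ _ hk]
      simp [hf0]

theorem hausdorffFMeasure_mono {f : ℝ≥0 → ℝ≥0} {A B : Set (EuclideanSpace ℝ ι)} (h : A ⊆ B) :
    hausdorffFMeasure f A ≤ hausdorffFMeasure f B := by
  unfold hausdorffFMeasure hausdorffPre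
  gcongr
  exact le_iInf fun hB => iInf_le_of_le (h.trans hB) le_rfl

theorem hausdorffFMeasure_union_le {f : ℝ≥0 → ℝ≥0} (hf0 : f 0 = 0)
    (A B : Set (EuclideanSpace ℝ ι)) :
    hausdorffFMeasure f (A ∪ B) ≤ hausdorffFMeasure f A + hausdorffFMeasure f B := by
  refine iSup₂_le fun ρ hρ => ?_
  refine le_trans ?_ (add_le_add
    (le_iSup₂_of_le (f := fun ρ _ => hausdorffPre f ρ A) ρ hρ le_rfl)
    (le_iSup₂_of_le (f := fun ρ _ => hausdorffPre f ρ B) ρ hρ le_rfl))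
  rw [hausdorffPre.eq_def f ρ A, hausdorffPre.eq_def f ρ B]
  simp only [ENNReal.iInf_add, ENNReal.add_iInf]
  refine le_iInf fun c₁ => le_iInf fun r₁ => le_iInf fun h₁ => le_iInf fun hB =>
    le_iInf fun c₂ => le_iInf fun r₂ => le_iInf fun h₂ => le_iInf fun hA => ?_
  refine (hausdorffPre_le_tsum_of_countable hf0 (Sum.elim c₁ c₂) (Sum.elim r₁ r₂) ?_ ?_).trans ?_
  · rintro (i | i)
    · exact h₁ i
    · exact h₂ i
  · rintro x (hx | hx)
    · obtain ⟨i, hi⟩ := mem_iUnion.1 (hA hx)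
      exact mem_iUnion.2 ⟨Sum.inr i, hi⟩
    · obtain ⟨i, hi⟩ := mem_iUnion.1 (hB hx)
      exact mem_iUnion.2 ⟨Sum.inl i, hi⟩
  · rw [ENNReal.summable.tsum_sum ENNReal.summable]
    simp only [Sum.elim_inl, Sum.elim_inr]
    exact add_comm _ _ |>.le

/-- If `f(r)` is at most a multiple of `r ^ dim` for small `r`, then Lebesgue null sets have
`f`-measure zero. -/
theorem hausdorffFMeasure_eq_zero_of_null {f : ℝ≥0 → ℝ≥0} (hf0 : f 0 = 0) {C r₀ : ℝ≥0}
    (hr₀ : 0 < r₀) (hf : ∀ r, 0 < r → r ≤ r₀ → f r ≤ C * r ^ Fintype.card ι)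
    {F : Set (EuclideanSpace ℝ ι)} (hF : volume F = 0) : hausdorffFMeasure f F = 0 := by
  refine le_antisymm (iSup₂_le fun ρ hρ => ?_) zero_le
  set v := volume (Metric.ball (0 : EuclideanSpace ℝ ι) 1) with hv
  have hv0 : v ≠ 0 := (Metric.measure_ball_pos volume _ one_pos).ne'
  have hvt : v ≠ ∞ := measure_ball_lt_top.ne
  refine le_of_forall_pos_le_add fun ε hε => ?_
  have hC : (C + 1 : ℝ≥0∞) ≠ 0 := by positivity
  -- The total volume is prescribed so that `(C + 1) * ∑ r ^ dim ≤ ε`; `C + 1` keeps the divisor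
  -- nonzero.
  obtain ⟨t, r, htc, -, hrt, hcov, hsum⟩ :=
    Besicovitch.exists_closedBall_covering_tsum_measure_le (α := EuclideanSpace ℝ ι) volume
      (ε := v * ε / (C + 1))
      (ENNReal.div_ne_zero.2 ⟨mul_ne_zero hv0 hε.ne', by finiteness⟩)
      (fun _ => Ioo 0 (min ρ r₀ : ℝ)) F (by
        intro x _ δ hδ
        have h1 : (0 : ℝ) < min (min (ρ : ℝ) r₀) δ :=
          lt_min (lt_min (by exact_mod_cast hρ) (by exact_mod_cast hr₀)) hδ
        refine ⟨min (min (ρ : ℝ) r₀) δ / 2, ⟨by positivity, ?_⟩, by positivity, ?_⟩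
        · linarith [min_le_left (min (ρ : ℝ) r₀) δ]
        · linarith [min_le_right (min (ρ : ℝ) r₀) δ])
  have := htc.to_subtype
  have hr0 : ∀ x : t, 0 < r x := fun x => (hrt x x.2).1
  rw [hF, zero_add] at hsum
  have hball : ∀ x : t, volume (Metric.closedBall (x : EuclideanSpace ℝ ι) (r x)) =
      ((r x).toNNReal : ℝ≥0∞) ^ Fintype.card ι * v := by
    intro x
    rw [Measure.addHaar_closedBall _ _ (hr0 x).le, finrank_euclideanSpace,
      ENNReal.ofReal_pow (hr0 x).le]
    rfl
  simp only [hball] at hsum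
  rw [ENNReal.tsum_mul_right] at hsum
  rw [zero_add]
  refine (hausdorffPre_le_tsum_of_countable hf0 (fun x : t => (x : EuclideanSpace ℝ ι))
    (fun x => (r x).toNNReal) ?_ ?_).trans ?_
  · intro x
    exact Real.toNNReal_le_iff_le_coe.2 ((hrt x x.2).2.le.trans (min_le_left _ _))
  · intro y hy
    obtain ⟨x, hx, hxy⟩ := mem_iUnion₂.1 (hcov hy)
    refine mem_iUnion.2 ⟨⟨x, hx⟩, ?_⟩
    rwa [Real.coe_toNNReal _ (hr0 ⟨x, hx⟩).le]
  · have h1 : ∑' x : t, (f (r x).toNNReal : ℝ≥0∞) ≤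
        (C + 1) * ∑' x : t, ((r x).toNNReal : ℝ≥0∞) ^ Fintype.card ι := by
      rw [← ENNReal.tsum_mul_left]
      refine ENNReal.tsum_le_tsum fun x => ?_
      have h2 := hf (r x).toNNReal (Real.toNNReal_pos.2 (hr0 x))
        (Real.toNNReal_le_iff_le_coe.2 ((hrt x x.2).2.le.trans (min_le_right _ _)))
      have h3 : f (r x).toNNReal ≤ (C + 1) * (r x).toNNReal ^ Fintype.card ι :=
        h2.trans (by gcongr; exact le_self_add)
      exact_mod_cast h3
    refine h1.trans ?_
    have h4 : (∑' x : t, ((r x).toNNReal : ℝ≥0∞) ^ Fintype.card ι) * (C + 1) * v ≤ ε * v := by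
      calc _ = (∑' x : t, ((r x).toNNReal : ℝ≥0∞) ^ Fintype.card ι) * v * (C + 1) := by ring
        _ ≤ v * ε / (C + 1) * (C + 1) := by gcongr
        _ = ε * v := by rw [ENNReal.div_mul_cancel hC (by finiteness), mul_comm]
    rw [mul_comm]
    exact (ENNReal.mul_le_mul_iff_left hv0 hvt).1 h4

end HausdorffMeasure

/-! ### Modifying divergent series without losing divergence. -/

section DivergentSums

theorem tsum_coe_ne_top_of_eventually_le {ι : Type*} {c d : ι → ℝ≥0}
    (h : ∀ᶠ i in cofinite, c i ≤ d i) (hd : ∑' i, (d i : ℝ≥0∞) ≠ ∞) :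
    ∑' i, (c i : ℝ≥0∞) ≠ ∞ := by
  rw [ENNReal.tsum_coe_ne_top_iff_summable] at hd ⊢
  rw [← NNReal.summable_coe] at hd ⊢
  refine hd.of_norm_bounded_eventually ?_
  filter_upwards [h] with i hi
  simpa using hi

/-- The terms of a divergent series can be truncated at `1`. -/
theorem tsum_min_one_eq_top {ι : Type*} {c : ι → ℝ≥0} (hc : ∑' i, (c i : ℝ≥0∞) = ∞) :
    ∑' i, ((min (c i) 1 : ℝ≥0) : ℝ≥0∞) = ∞ := by
  by_contra hne
  refine tsum_coe_ne_top_of_eventually_le ?_ hne hc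
  have hfin := ENNReal.finite_const_le_of_tsum_ne_top hne one_ne_zero
  filter_upwards [hfin.compl_mem_cofinite] with i hi
  have h1 : ¬ (1 : ℝ≥0) ≤ min (c i) 1 := fun h => hi (by
    rw [mem_ofPred_eq]; exact_mod_cast h)
  rcases min_cases (c i) 1 with h | h
  · rw [h.1]
  · exact absurd h.1.ge h1

/-- Abel–Dini: divide by the partial sums `P`. A block from `N` to `M` contributes at least `(P M -
P N) / P M ≥ 1 / 2` once `P M ≥ 2 * P N`, so the tails do not tend to zero. -/
theorem exists_tendsto_zero_tsum_nat_mul_eq_top {c : ℕ → ℝ≥0} (hc : ∑' i, (c i : ℝ≥0∞) = ∞) :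
    ∃ ε : ℕ → ℝ≥0, Tendsto ε atTop (𝓝 0) ∧ ∑' i, ((ε i * c i : ℝ≥0) : ℝ≥0∞) = ∞ := by
  set P : ℕ → ℝ≥0 := fun n => 1 + ∑ i ∈ Finset.range n, c i with hP
  have hP1 : ∀ n, 1 ≤ P n := fun n => le_self_add
  have hP0 : ∀ n, 0 < P n := fun n => one_pos.trans_le (hP1 n)
  have hPs : ∀ n, P (n + 1) = P n + c n := fun n => by
    simp only [hP, Finset.sum_range_succ, add_assoc]
  have hPmono : Monotone P := monotone_nat_of_le_succ fun n => by rw [hPs]; exact le_self_add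
  have hPtop : Tendsto P atTop atTop := by
    have h1 := ENNReal.tendsto_nat_tsum fun i => (c i : ℝ≥0∞)
    rw [hc] at h1
    refine tendsto_atTop.2 fun B => ?_
    filter_upwards [h1.eventually (lt_mem_nhds (ENNReal.coe_lt_top (r := B)))] with n hn
    have h2 : B < ∑ i ∈ Finset.range n, c i := by exact_mod_cast hn
    exact h2.le.trans le_add_self
  refine ⟨fun n => (P (n + 1))⁻¹,
    (tendsto_inv_atTop_zero.comp hPtop).comp (tendsto_add_atTop_nat 1), ?_⟩
  by_contra hne
  have hsumm := ENNReal.tsum_coe_ne_top_iff_summable.1 hne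
  have htail := NNReal.tendsto_sum_nat_add fun i => (P (i + 1))⁻¹ * c i
  obtain ⟨N, hN⟩ := (htail.eventually (gt_mem_nhds (show (0 : ℝ≥0) < 1 / 2 by positivity))).exists
  obtain ⟨M, hM, hNM⟩ :=
    ((hPtop.eventually_ge_atTop (2 * P N)).and (eventually_ge_atTop N)).exists
  obtain ⟨k, rfl⟩ := Nat.exists_eq_add_of_le hNM
  have htele : ∀ k, P (N + k) = P N + ∑ j ∈ Finset.range k, c (j + N) := by
    intro k
    induction k with
    | zero => simp
    | succ k ih => rw [Finset.sum_range_succ, ← add_assoc (P N), ← ih, ← add_assoc, hPs, add_comm k N]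
  have h1 : ∑ j ∈ Finset.range k, (P (N + k))⁻¹ * c (j + N) ≤
      ∑' j, (P (j + N + 1))⁻¹ * c (j + N) := by
    refine le_trans (Finset.sum_le_sum fun j hj => ?_)
      (Summable.sum_le_tsum (Finset.range k) (fun _ _ => zero_le)
        ((NNReal.summable_nat_add_iff N).2 hsumm))
    have : j + N + 1 ≤ N + k := by have := Finset.mem_range.1 hj; omega
    gcongr
    exact hPmono this
  rw [← Finset.mul_sum] at h1
  have h2 := h1.trans_lt hN
  rw [inv_mul_lt_iff₀ (hP0 _)] at h2
  have h3 := htele k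
  have h2' : ((∑ j ∈ Finset.range k, c (j + N) : ℝ≥0) : ℝ) < P (N + k) * (1 / 2) := by
    exact_mod_cast h2
  have h3' : (P (N + k) : ℝ) = P N + (∑ j ∈ Finset.range k, c (j + N) : ℝ≥0) := by
    exact_mod_cast h3
  have hM' : (2 * P N : ℝ) ≤ P (N + k) := by exact_mod_cast hM
  linarith

/-- The terms of a divergent series can be multiplied with a null sequence, keeping the series
divergent. -/
theorem exists_tendsto_zero_tsum_mul_eq_top {ι : Type*} [Countable ι] [Infinite ι] {c : ι → ℝ≥0}
    (hc : ∑' i, (c i : ℝ≥0∞) = ∞) :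
    ∃ ε : ι → ℝ≥0, Tendsto ε cofinite (𝓝 0) ∧ ∑' i, ((ε i * c i : ℝ≥0) : ℝ≥0∞) = ∞ := by
  obtain ⟨_⟩ := nonempty_denumerable ι
  let e := Denumerable.eqv ι
  obtain ⟨ε, h1, h2⟩ := exists_tendsto_zero_tsum_nat_mul_eq_top (c := c ∘ e.symm)
    (by rw [← hc]; exact e.symm.tsum_eq fun i => (c i : ℝ≥0∞))
  refine ⟨ε ∘ e, ?_, ?_⟩
  · rw [← Nat.cofinite_eq_atTop] at h1
    exact h1.comp e.injective.tendsto_cofinite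
  · rw [← h2, ← e.tsum_eq]
    simp

end DivergentSums

/-! ### Measurability of the approximable set and the volume of its complement. -/

section ApproxSet

variable {n m : ℕ}

theorem comap_norm_atTop_eq_cofinite :
    comap (fun a : Fin n → ℤ => ‖a‖) atTop = cofinite := by
  rw [comap_norm_atTop, Metric.cobounded_eq_cocompact, cocompact_eq_cofinite]

/-- Norm balls in `ℤ^n` are finite. This writes the approximable set as a limsup set, both for
measurability and for mass transference. -/
theorem infinite_iff_forall_exists_le_norm {S : Set (Fin n → ℤ)} :
    S.Infinite ↔ ∀ N : ℕ, ∃ a ∈ S, (N : ℝ) ≤ ‖a‖ := by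
  have hS : S.Infinite ↔ ∃ᶠ a in cofinite, a ∈ S := frequently_cofinite_iff_infinite.symm
  rw [hS, ← comap_norm_atTop_eq_cofinite, frequently_comap]
  constructor
  · intro h N
    obtain ⟨x, ⟨a, rfl, ha⟩, hx⟩ := (h.and_eventually (eventually_ge_atTop (N : ℝ))).exists
    exact ⟨a, ha, hx⟩
  · intro h
    refine frequently_atTop.2 fun x => ?_
    obtain ⟨N, hN⟩ := exists_nat_ge x
    obtain ⟨a, ha, haN⟩ := h N
    exact ⟨‖a‖, hN.trans haN, a, rfl, ha⟩

theorem measurable_distNearestInt : Measurable distNearestInt := by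
  have h : (fun x : ℝ => ((round x : ℤ) : ℝ)) = fun x => ((⌊x + 1 / 2⌋ : ℤ) : ℝ) := by
    funext x
    rw [round_eq]
  have : Measurable fun x : ℝ => ((round x : ℤ) : ℝ) := by
    rw [h]
    exact (measurable_from_top (f := fun k : ℤ => (k : ℝ))).comp
      (Int.measurable_floor.comp (measurable_id.add_const _))
  exact continuous_abs.measurable.comp (measurable_id.sub this)

theorem measurableSet_unitCube : MeasurableSet (unitCube n m) := by
  have : unitCube n m = ⋂ p, (fun X : EuclideanSpace ℝ (Fin m × Fin n) => X p) ⁻¹' Ico 0 1 := by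
    ext X
    simp [unitCube]
  rw [this]
  exact MeasurableSet.iInter fun p => measurableSet_Ico.preimage (by fun_prop)

theorem volume_unitCube : volume (unitCube n m) = 1 := by
  have h := (EuclideanSpace.volume_preserving_symm_measurableEquiv_toLp
    (Fin m × Fin n)).measure_preimage (s := Set.pi univ fun _ => Ico (0 : ℝ) 1)
    (MeasurableSet.univ_pi fun _ => measurableSet_Ico).nullMeasurableSet
  rw [Real.volume_pi_Ico] at h
  simp only [sub_zero, ENNReal.ofReal_one, Finset.prod_const_one] at h
  rw [← h]
  congr 1
  ext X
  simp [unitCube]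

theorem measurableSet_approxSet (b : Fin m → ℝ) (Ψ : (Fin n → ℤ) → ℝ≥0) :
    MeasurableSet (approxSet n m b Ψ) := by
  have : approxSet n m b Ψ = unitCube n m ∩ ⋂ N : ℕ, ⋃ a : Fin n → ℤ, ⋃ _ : (N : ℝ) ≤ ‖a‖,
      ⋂ j, {X | distNearestInt (∑ i, (a i : ℝ) * X (j, i) - b j) < (Ψ a : ℝ)} := by
    ext X
    simp only [approxSet, mem_ofPred_eq, infinite_iff_forall_exists_le_norm, mem_inter_iff,
      mem_iInter, mem_iUnion, exists_prop]
    simp only [and_comm]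
  rw [this]
  refine measurableSet_unitCube.inter (MeasurableSet.iInter fun N => MeasurableSet.iUnion fun a =>
    MeasurableSet.iUnion fun _ => MeasurableSet.iInter fun j => ?_)
  refine measurableSet_lt (measurable_distNearestInt.comp ?_) measurable_const
  fun_prop

theorem volume_unitCube_diff_approxSet {b : Fin m → ℝ} {Ψ : (Fin n → ℤ) → ℝ≥0}
    (h : volume (approxSet n m b Ψ) = 1) : volume (unitCube n m \ approxSet n m b Ψ) = 0 := by
  rw [measure_sdiff (fun X hX => hX.1) (measurableSet_approxSet b Ψ).nullMeasurableSet (by simp [h]),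
    h, volume_unitCube, tsub_self]

theorem card_prod_fin : Fintype.card (Fin m × Fin n) = n * m := by
  simp [mul_comm]

end ApproxSet

/-! ### The bounded and the unbounded regime for approximable points. -/

section Divergence

variable {n m : ℕ}

theorem slicedFunction_zero {f : ℝ≥0 → ℝ≥0} (hf0 : f 0 = 0) : slicedFunction n m f 0 = 0 := by
  simp [slicedFunction, hf0]

theorem IsDimensionFunction.map_zero {f : ℝ≥0 → ℝ≥0} (hf : IsDimensionFunction f) : f 0 = 0 :=
  tendsto_nhds_unique (hf.continuous.tendsto 0) hf.tendsto_zero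

/-- Carries the assumptions on `f` in dimension `n * m` over to `g` in the slice dimension `m`. -/
theorem slicedFunction_div_pow (hn : 1 ≤ n) (f : ℝ≥0 → ℝ≥0) (r : ℝ≥0) :
    slicedFunction n m f r / r ^ m = f r / r ^ (n * m) := by
  obtain ⟨k, rfl⟩ := Nat.exists_eq_add_of_le' hn
  rw [slicedFunction, div_div, ← pow_add, Nat.add_sub_cancel, Nat.succ_mul]

theorem one_le_nnnorm_of_ne_zero {a : Fin n → ℤ} (ha : a ≠ 0) : 1 ≤ ‖a‖₊ := by
  obtain ⟨i, hi⟩ := Function.ne_iff.1 ha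
  refine le_trans ?_ (nnnorm_le_pi_nnnorm a i)
  rw [← NNReal.coe_le_coe, coe_nnnorm, Int.norm_eq_abs, ← Int.cast_abs, NNReal.coe_one,
    ← Int.cast_one]
  exact Int.cast_le.2 (Int.one_le_abs hi)

/-- If `f(r)` is at most a multiple of `r ^ (n * m)` for small `r`, then the Hausdorff measure
statement is a consequence of the Lebesgue measure statement for the same `Ψ`. -/
theorem hausdorffFMeasure_approxSet_of_bounded (hn : 1 ≤ n) {b : Fin m → ℝ}
    (schmidt : SchmidtDivergentPart n m b) {Ψ : (Fin n → ℤ) → ℝ≥0} (hΨ : VanishesAtInfinity Ψ)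
    {f : ℝ≥0 → ℝ≥0} (hf0 : f 0 = 0) {C r₀ : ℝ≥0} (hr₀ : 0 < r₀)
    (hC : ∀ r, 0 < r → r ≤ r₀ → f r ≤ C * r ^ (n * m))
    (hsum : ∑' a : {a : Fin n → ℤ // a ≠ 0},
      ((slicedFunction n m f (Ψ a.1 / ‖a.1‖₊) * ‖a.1‖₊ ^ m : ℝ≥0) : ℝ≥0∞) = ∞) :
    hausdorffFMeasure f (approxSet n m b Ψ) = hausdorffFMeasure f (unitCube n m) := by
  have hdiv : ∑' a : Fin n → ℤ, (Ψ a : ℝ≥0∞) ^ m = ∞ := by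
    by_contra hne
    have hne' : ∑' a : {a : Fin n → ℤ // a ≠ 0}, ((C * Ψ a.1 ^ m : ℝ≥0) : ℝ≥0∞) ≠ ∞ := by
      push_cast
      rw [ENNReal.tsum_mul_left]
      refine ENNReal.mul_ne_top ENNReal.coe_ne_top (ne_top_of_le_ne_top hne ?_)
      exact ENNReal.tsum_comp_le_tsum_of_injective Subtype.val_injective
        fun a => (Ψ a : ℝ≥0∞) ^ m
    refine tsum_coe_ne_top_of_eventually_le ?_ hne' hsum
    have h1 : ∀ᶠ a in cofinite, Ψ a < r₀ := by
      rw [VanishesAtInfinity, comap_norm_atTop_eq_cofinite] at hΨ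
      exact hΨ.eventually (gt_mem_nhds hr₀)
    filter_upwards [Subtype.val_injective.tendsto_cofinite.eventually h1] with a ha
    have hnorm := one_le_nnnorm_of_ne_zero a.2
    have hnorm0 : 0 < ‖a.1‖₊ := one_pos.trans_le hnorm
    rcases (zero_le : 0 ≤ Ψ a.1).eq_or_lt with h0 | h0
    · rw [← h0, zero_div, slicedFunction_zero hf0, zero_mul]
      exact zero_le
    · have hr : 0 < Ψ a.1 / ‖a.1‖₊ := div_pos h0 hnorm0
      have hr' : Ψ a.1 / ‖a.1‖₊ ≤ r₀ := (div_le_self zero_le hnorm).trans ha.le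
      have h2 : slicedFunction n m f (Ψ a.1 / ‖a.1‖₊) ≤ C * (Ψ a.1 / ‖a.1‖₊) ^ m := by
        rw [← div_le_iff₀ (pow_pos hr m), slicedFunction_div_pow hn, div_le_iff₀ (pow_pos hr _)]
        exact hC _ hr hr'
      calc _ ≤ C * (Ψ a.1 / ‖a.1‖₊) ^ m * ‖a.1‖₊ ^ m := by gcongr
        _ = C * Ψ a.1 ^ m := by rw [mul_assoc, ← mul_pow, div_mul_cancel₀ _ hnorm0.ne']
  have hnull := volume_unitCube_diff_approxSet (schmidt Ψ hΨ hdiv)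
  refine le_antisymm (hausdorffFMeasure_mono fun X hX => hX.1) ?_
  calc hausdorffFMeasure f (unitCube n m)
      ≤ hausdorffFMeasure f (approxSet n m b Ψ ∪ unitCube n m \ approxSet n m b Ψ) :=
        hausdorffFMeasure_mono fun X hX => by
          by_cases h : X ∈ approxSet n m b Ψ
          · exact Or.inl h
          · exact Or.inr ⟨hX, h⟩
    _ ≤ _ := hausdorffFMeasure_union_le hf0 _ _
    _ = hausdorffFMeasure f (approxSet n m b Ψ) := by
      rw [hausdorffFMeasure_eq_zero_of_null hf0 hr₀ (C := C) (by rwa [card_prod_fin]) hnull,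
        add_zero]

/-- One of the coordinates realizes the maximum norm along a divergent part of the series. -/
theorem exists_coordinate_tsum_eq_top (hn : 1 ≤ n) {c : (Fin n → ℤ) → ℝ≥0}
    (hc : ∑' a : {a : Fin n → ℤ // a ≠ 0}, (c a.1 : ℝ≥0∞) = ∞) :
    ∃ i₀, ∑' a, (({a : Fin n → ℤ | a ≠ 0 ∧ ‖a i₀‖ = ‖a‖}.indicator c a : ℝ≥0) : ℝ≥0∞) = ∞ := by
  by_contra! hne
  have := Fin.pos_iff_nonempty.1 hn
  have h1 : ∑' a : {a : Fin n → ℤ // a ≠ 0}, (c a.1 : ℝ≥0∞) ≤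
      ∑' a, ∑' i₀ : Fin n,
        (({a : Fin n → ℤ | a ≠ 0 ∧ ‖a i₀‖ = ‖a‖}.indicator c a : ℝ≥0) : ℝ≥0∞) := by
    refine le_trans (ENNReal.tsum_le_tsum fun a => ?_)
      (ENNReal.tsum_comp_le_tsum_of_injective Subtype.val_injective _)
    obtain ⟨i₀, -, hi₀⟩ := Finset.exists_mem_eq_sup Finset.univ Finset.univ_nonempty
      fun i => ‖a.1 i‖₊
    refine le_trans (le_of_eq ?_) (ENNReal.le_tsum i₀)
    rw [indicator_of_mem (by exact ⟨a.2, by rw [Pi.norm_def, hi₀, coe_nnnorm]⟩)]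
  rw [hc, ENNReal.tsum_comm, tsum_fintype, top_le_iff] at h1
  exact ENNReal.sum_ne_top.2 (fun i _ => hne i) h1

theorem card_coordinate (i₀ : Fin n) :
    Fintype.card {p : Fin m × Fin n // p.2 = i₀} = m := by
  conv_rhs => rw [← Fintype.card_fin m]
  exact Fintype.card_congr ⟨fun p => p.1.1, fun j => ⟨(j, i₀), rfl⟩, fun p => by
    obtain ⟨⟨j, i⟩, rfl⟩ := p; rfl, fun j => rfl⟩

theorem card_not_coordinate (i₀ : Fin n) :
    Fintype.card {p : Fin m × Fin n // ¬p.2 = i₀} = (n - 1) * m := by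
  rw [Fintype.card_subtype_compl, card_coordinate, card_prod_fin, Nat.sub_mul, one_mul]

/-- Moving the coordinates `(j, i₀)` only. -/
theorem sum_mul_gluePoint_sub (i₀ : Fin n) (a : Fin n → ℤ)
    (z z' : {p : Fin m × Fin n // p.2 = i₀} → ℝ) (y : {p : Fin m × Fin n // ¬p.2 = i₀} → ℝ)
    (j : Fin m) :
    ∑ i, (a i : ℝ) * gluePoint (fun p : Fin m × Fin n => p.2 = i₀) z' y (j, i) =
      ∑ i, (a i : ℝ) * gluePoint (fun p : Fin m × Fin n => p.2 = i₀) z y (j, i) +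
        a i₀ * (z' ⟨(j, i₀), rfl⟩ - z ⟨(j, i₀), rfl⟩) := by
  rw [← sub_eq_iff_eq_add', ← Finset.sum_sub_distrib, Finset.sum_eq_single i₀]
  · rw [← mul_sub]
    have h := gluePoint_apply_of_pos (fun p : Fin m × Fin n => p.2 = i₀) z' y ⟨(j, i₀), rfl⟩
    have h' := gluePoint_apply_of_pos (fun p : Fin m × Fin n => p.2 = i₀) z y ⟨(j, i₀), rfl⟩
    dsimp only at h h'
    rw [h, h']
  · intro i _ hi
    have h := gluePoint_apply_of_neg (fun p : Fin m × Fin n => p.2 = i₀) z' y ⟨(j, i), hi⟩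
    have h' := gluePoint_apply_of_neg (fun p : Fin m × Fin n => p.2 = i₀) z y ⟨(j, i), hi⟩
    dsimp only at h h'
    rw [h, h', sub_self]
  · simp

/-- A point approximated to within `Φ a` by `a` lies close to the centre of a ball of points
approximated to within `Ψ a`. -/
theorem exists_ball_of_distNearestInt_lt [NeZero m] {b : Fin m → ℝ} {i₀ : Fin n} {a : Fin n → ℤ}
    (ha : a ≠ 0) (hai : ‖a i₀‖ = ‖a‖) {φ ψ : ℝ≥0}
    {z : {p : Fin m × Fin n // p.2 = i₀} → ℝ} {y : {p : Fin m × Fin n // ¬p.2 = i₀} → ℝ}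
    (hz : ∀ j, distNearestInt (∑ i, (a i : ℝ) *
      gluePoint (fun p : Fin m × Fin n => p.2 = i₀) z y (j, i) - b j) < (φ : ℝ)) :
    ∃ c, dist z c < (φ / ‖a‖₊ : ℝ≥0) ∧ ∀ z' ∈ Metric.ball c ((ψ / ‖a‖₊ : ℝ≥0) : ℝ),
      ∀ j, distNearestInt (∑ i, (a i : ℝ) *
        gluePoint (fun p : Fin m × Fin n => p.2 = i₀) z' y (j, i) - b j) < (ψ : ℝ) := by
  set L : Fin m → ℝ := fun j => ∑ i, (a i : ℝ) *
    gluePoint (fun p : Fin m × Fin n => p.2 = i₀) z y (j, i) - b j with hL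
  have hnorm : 0 < ‖a‖ := norm_pos_iff.2 ha
  have habs : |(a i₀ : ℝ)| = ‖a‖ := by rw [← hai, Int.norm_eq_abs]
  have hai0 : (a i₀ : ℝ) ≠ 0 := by
    intro h
    rw [h, abs_zero] at habs
    exact hnorm.ne habs
  have hφ : (0 : ℝ) < φ := (abs_nonneg _).trans_lt (hz 0)
  -- The centre solves `a · x_j - b_j = round (L j)` exactly, by moving only the coordinates `(j,
  -- i₀)`.
  refine ⟨fun p => z p - (L p.1.1 - round (L p.1.1)) / a i₀, ?_, fun z' hz' j => ?_⟩
  · have hpos : (0 : ℝ) < (φ / ‖a‖₊ : ℝ≥0) := by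
      rw [NNReal.coe_div, coe_nnnorm]
      positivity
    rw [dist_pi_lt_iff hpos]
    intro p
    rw [Real.dist_eq, sub_sub_cancel, abs_div, habs, NNReal.coe_div, coe_nnnorm]
    exact div_lt_div_of_pos_right (hz p.1.1) hnorm
  · refine (round_le _ (round (L j))).trans_lt ?_
    rw [sum_mul_gluePoint_sub i₀ a z z' y j]
    have h1 : dist (z' ⟨(j, i₀), rfl⟩) (z ⟨(j, i₀), rfl⟩ - (L j - round (L j)) / a i₀) <
        ((ψ / ‖a‖₊ : ℝ≥0) : ℝ) := (dist_le_pi_dist z' _ ⟨(j, i₀), rfl⟩).trans_lt hz'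
    rw [Real.dist_eq, NNReal.coe_div, coe_nnnorm, lt_div_iff₀ hnorm, ← habs, ← abs_mul] at h1
    refine lt_of_eq_of_lt ?_ h1
    congr 1
    rw [sub_mul, sub_mul, div_mul_cancel₀ _ hai0]
    simp only [hL]
    ring

/-- If `f(r) / r ^ (n * m)` increases to infinity as `r` tends to `0`, then the set of
approximable points has infinite measure. -/
theorem hausdorffFMeasure_approxSet_eq_top (hn : 1 ≤ n) (hm : 1 ≤ m) {b : Fin m → ℝ}
    (schmidt : SchmidtDivergentPart n m b) {Ψ : (Fin n → ℤ) → ℝ≥0}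
    {f : ℝ≥0 → ℝ≥0} (hf0 : f 0 = 0)
    (hanti : AntitoneOn (fun r => f r / r ^ (n * m)) (Ioi 0))
    (hunb : ∀ C : ℝ≥0, ∃ r : ℝ≥0, 0 < r ∧ C < f r / r ^ (n * m))
    (hg : IsDimensionFunction (slicedFunction n m f))
    (hsum : ∑' a : {a : Fin n → ℤ // a ≠ 0},
      ((slicedFunction n m f (Ψ a.1 / ‖a.1‖₊) * ‖a.1‖₊ ^ m : ℝ≥0) : ℝ≥0∞) = ∞) :
    hausdorffFMeasure f (approxSet n m b Ψ) = ∞ := by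
  set g := slicedFunction n m f with hgdef
  have hg0 : g 0 = 0 := slicedFunction_zero hf0
  simp only [← slicedFunction_div_pow hn, ← hgdef] at hanti hunb
  have : NeZero m := ⟨by omega⟩
  have := Fin.pos_iff_nonempty.1 hn
  obtain ⟨i₀, hi₀⟩ := exists_coordinate_tsum_eq_top hn
    (c := fun a => g (Ψ a / ‖a‖₊) * ‖a‖₊ ^ m) hsum
  set S : Set (Fin n → ℤ) := {a | a ≠ 0 ∧ ‖a i₀‖ = ‖a‖} with hS
  set c : (Fin n → ℤ) → ℝ≥0 := S.indicator fun a => g (Ψ a / ‖a‖₊) * ‖a‖₊ ^ m with hc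
  obtain ⟨η, hη, hηsum⟩ := exists_tendsto_zero_tsum_mul_eq_top (tsum_min_one_eq_top hi₀)
  -- Truncation and `η → 0` make `Φ` vanish at infinity; `η` also supplies the arbitrarily small `ε`
  -- of `IsGaugeUbiquitous`.
  set Φ : (Fin n → ℤ) → ℝ≥0 := fun a => (η a * min (c a) 1) ^ ((m : ℝ)⁻¹) with hΦ
  have hΦpow : ∀ a, Φ a ^ m = η a * min (c a) 1 := fun a =>
    NNReal.rpow_inv_natCast_pow _ (NeZero.ne m)
  have hΦlim : VanishesAtInfinity Φ := by
    rw [VanishesAtInfinity, comap_norm_atTop_eq_cofinite]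
    have h1 : Tendsto (fun a => η a * min (c a) 1) cofinite (𝓝 0) :=
      tendsto_of_tendsto_of_tendsto_of_le_of_le tendsto_const_nhds hη (fun _ => zero_le)
        fun a => mul_le_of_le_one_right zero_le (min_le_right _ _)
    have hm0 : (0 : ℝ) < (m : ℝ)⁻¹ := by
      have := NeZero.pos m
      positivity
    have h2 := (NNReal.continuous_rpow_const hm0.le).tendsto 0
    rw [NNReal.zero_rpow hm0.ne'] at h2
    exact h2.comp h1
  have hnull := volume_unitCube_diff_approxSet (schmidt Φ hΦlim (by
    rw [← hηsum]
    refine tsum_congr fun a => ?_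
    rw [← hΦpow]
    push_cast
    rfl))
  let p : Fin m × Fin n → Prop := fun q => q.2 = i₀
  -- Fubini; the swap makes the frozen coordinates `y` the outer variable.
  have hslices : ∀ᵐ y : {q // ¬p q} → ℝ, ∀ᵐ z : {q // p q} → ℝ,
      gluePoint p z y ∉ unitCube n m \ approxSet n m b Φ :=
    Measure.ae_ae_of_ae_prod (((measurePreserving_gluePoint p).comp
      Measure.measurePreserving_swap).quasiMeasurePreserving.ae
        (measure_eq_zero_iff_ae_notMem.1 hnull))
  have hcard : Fintype.card {q // p q} = m := card_coordinate i₀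
  set Y : Set ({q // ¬p q} → ℝ) := Set.pi univ fun _ => Ico (0 : ℝ) 1 with hY
  set U : Set ({q // p q} → ℝ) := Set.pi univ fun _ => Ico (0 : ℝ) 1 with hU
  have hcube : ∀ y ∈ Y, ∀ z ∈ U, gluePoint p z y ∈ unitCube n m := by
    intro y hy z hz q
    by_cases hq : p q
    · rw [gluePoint_apply_of_pos p z y ⟨q, hq⟩]
      exact hz _ (mem_univ _)
    · rw [gluePoint_apply_of_neg p z y ⟨q, hq⟩]
      exact hy _ (mem_univ _)
  refine hausdorffFMeasure_eq_top_of_slices p (g := g) hg0 (fun r => ?_) (Y := Y) ?_ ?_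
  · rw [card_not_coordinate i₀]
    by_cases hr : r ^ ((n - 1) * m) = 0
    · rw [hr, mul_zero]
      exact zero_le
    · exact (div_mul_cancel₀ _ hr).le
  · rw [hY, Real.volume_pi_Ico]
    simp
  rw [ae_restrict_iff' (MeasurableSet.univ_pi fun _ => measurableSet_Ico)]
  filter_upwards [hslices] with y hy hyY
  have : Nonempty {q // p q} := ⟨⟨(0, i₀), rfl⟩⟩
  set O : ℕ → Set ({q // p q} → ℝ) := fun N => {z | ∃ a : Fin n → ℤ, (N : ℝ) ≤ ‖a‖ ∧
    ∀ j, distNearestInt (∑ i, (a i : ℝ) * gluePoint p z y (j, i) - b j) < (Ψ a : ℝ)} with hO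
  have hmain : HasInfiniteGaugeMeasure g {z ∈ U | ∀ N, z ∈ O N} := by
    refine hasInfiniteGaugeMeasure_of_ubiquitous hg.monotone hg.tendsto_zero
      (by rwa [hcard]) (by rwa [hcard]) (fun N ε hε δ hδ => ?_) (x := fun _ => 1 / 2) (R := 1 / 4)
      (by positivity) ?_
    swap
    · intro z hz q _
      have := (dist_le_pi_dist z _ q).trans hz
      rw [Real.dist_eq, abs_le] at this
      push_cast at this
      constructor <;> linarith
    obtain ⟨r₁, hr₁, hr₁g⟩ := hunb (1 / ε)
    have hfat : ∀ r, 0 < r → r ≤ r₁ → r ^ m ≤ ε * g r := by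
      intro r hr hrr
      have h1 := hr₁g.le.trans (hanti (mem_Ioi.2 hr) (mem_Ioi.2 hr₁) hrr)
      rwa [div_le_div_iff₀ hε (pow_pos hr m), one_mul, mul_comm] at h1
    filter_upwards [hy] with z hz hzU
    have hzW : gluePoint p z y ∈ approxSet n m b Φ := by
      by_contra h
      exact hz ⟨hcube y hyY z hzU, h⟩
    have hev : ∀ᶠ a : Fin n → ℤ in cofinite,
        max (N : ℝ) (((min δ r₁)⁻¹ : ℝ≥0) : ℝ) ≤ ‖a‖ ∧ η a < min ε 1 := by
      refine Eventually.and ?_ (hη.eventually (gt_mem_nhds (lt_min hε one_pos)))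
      rw [← comap_norm_atTop_eq_cofinite]
      exact tendsto_comap.eventually (eventually_ge_atTop _)
    obtain ⟨a, ha, haN, haη⟩ :=
      ((frequently_cofinite_iff_infinite.2 hzW.2).and_eventually hev).exists
    have hΦa : 0 < Φ a := by exact_mod_cast (abs_nonneg _).trans_lt (ha 0)
    -- `Φ` vanishes off `S`, so only vectors whose norm is attained at `i₀` can approximate.
    have hca : c a ≠ 0 := by
      intro h
      have h1 := hΦpow a
      rw [h, min_eq_left zero_le, mul_zero] at h1
      exact (pow_pos hΦa m).ne' h1
    have haS : a ∈ S := mem_of_indicator_ne_zero hca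
    have hcval : c a = g (Ψ a / ‖a‖₊) * ‖a‖₊ ^ m := indicator_of_mem haS _
    have hnorm : 0 < ‖a‖₊ := nnnorm_pos.2 haS.1
    have hΨa : 0 < Ψ a / ‖a‖₊ := by
      rw [pos_iff_ne_zero]
      intro h
      rw [hcval, h, hg0, zero_mul] at hca
      exact hca rfl
    have hΦ1 : Φ a ≤ 1 := by
      refine (pow_le_one_iff_of_nonneg zero_le (NeZero.ne m)).1 ?_
      rw [hΦpow]
      exact mul_le_one₀ (haη.le.trans (min_le_right _ _)) zero_le (min_le_right _ _)
    have hρ : Φ a / ‖a‖₊ ≤ min δ r₁ := by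
      have h1 : (min δ r₁)⁻¹ ≤ ‖a‖₊ := by
        rw [← NNReal.coe_le_coe, coe_nnnorm]
        exact (le_max_right _ _).trans haN
      rw [inv_le_iff_one_le_mul₀ (lt_min hδ hr₁)] at h1
      rw [div_le_iff₀ hnorm, mul_comm]
      exact hΦ1.trans h1
    obtain ⟨x, hx, hball⟩ := exists_ball_of_distNearestInt_lt (ψ := Ψ a) haS.1 haS.2 ha
    -- The minimum enforces `r ≤ ρ`. If it is `Ψ a / ‖a‖₊`, the definition of `Φ` gives the gauge
    -- bound; otherwise `r = ρ`, and `hfat` gives it at small scales.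
    refine ⟨x, min (Ψ a / ‖a‖₊) (Φ a / ‖a‖₊), Φ a / ‖a‖₊, hx, lt_min hΨa (div_pos hΦa hnorm),
      min_le_right _ _, hρ.trans (min_le_left _ _), ?_, ?_⟩
    · rw [hcard]
      rcases min_cases (Ψ a / ‖a‖₊) (Φ a / ‖a‖₊) with h | h
      · rw [h.1, div_pow, div_le_iff₀ (pow_pos hnorm m), hΦpow, mul_assoc, ← hcval]
        exact mul_le_mul (haη.le.trans (min_le_left _ _)) (min_le_left _ _) zero_le zero_le
      · rw [h.1]
        exact hfat _ (div_pos hΦa hnorm) (hρ.trans (min_le_right _ _))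
    · intro z' hz'
      refine ⟨a, (le_max_left _ _).trans haN, hball z' (Metric.ball_subset_ball ?_ hz')⟩
      exact_mod_cast min_le_left _ _
  intro T
  obtain ⟨ρ, hρ, h⟩ := hmain T
  refine ⟨ρ, hρ, fun d s hs hcov => h d s hs fun z hz => hcov ⟨hcube y hyY z hz.1, ?_⟩⟩
  rw [infinite_iff_forall_exists_le_norm]
  intro N
  obtain ⟨a, ha, haN⟩ := hz.2 N
  exact ⟨a, haN, ha⟩

end Divergence

/-- The divergent part of Schmidt's theorem implies the divergent part of the general theorem
on Hausdorff measures, with the same `n`, `m` and `b`. -/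
theorem theorem2 (n m : ℕ) (hn : 1 ≤ n) (hm : 1 ≤ m) (hnm : 2 < n + m) (b : Fin m → ℝ)
    (schmidt : SchmidtDivergentPart n m b) : HausdorffDivergentPart n m b := by
  intro Ψ hΨ f hf hmon hg hsum
  have hf0 := hf.map_zero
  rcases hmon with hmon | hanti
  · refine hausdorffFMeasure_approxSet_of_bounded hn schmidt hΨ hf0 (C := f 1) (r₀ := 1)
      one_pos (fun r hr hr1 => ?_) hsum
    have := hmon (mem_Ioi.2 hr) (mem_Ioi.2 one_pos) hr1
    simp only [one_pow, div_one] at this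
    exact (div_le_iff₀ (pow_pos hr _)).1 this
  -- In the unbounded case both sides are infinite, since the cube contains the approximable set.
  · by_cases hunb : ∀ C : ℝ≥0, ∃ r : ℝ≥0, 0 < r ∧ C < f r / r ^ (n * m)
    · have htop := hausdorffFMeasure_approxSet_eq_top hn hm schmidt hf0 hanti hunb hg hsum
      rw [htop, eq_comm, ← top_le_iff, ← htop]
      exact hausdorffFMeasure_mono fun X hX => hX.1
    · push Not at hunb
      obtain ⟨C, hC⟩ := hunb
      exact hausdorffFMeasure_approxSet_of_bounded hn schmidt hΨ hf0 (C := C) (r₀ := 1)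
        one_pos (fun r hr _ => (div_le_iff₀ (pow_pos hr _)).1 (hC r hr)) hsum
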